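/- Let $G$ be a finite group and $V$ a finite-dimensional complex representation of $G$. Let $(W_i)_{i\in I}$ be a family of irreducible complex representations of $G$ containing each irreducible representation exactly once up to isomorphism, and put $W=\bigoplus_{i\in I}W_i$. Let $G$ act on $S^{\bullet}V^*$ by the algebra automorphisms induced by the dual representation $V^*$, and on $\operatorname{End}(W)$ by conjugation. Then the algebra of invariants $$B=\bigl(S^{\bullet}V^{*}\otimes \operatorname{End}(W)^{\mathrm{op}}\bigr)^{G},\qquad B_d=\bigl(S^{d}V^{*}\otimes \operatorname{End}(W)^{\mathrm{op}}\bigr)^{G},$$ graded by the degree in $S^{\bullet}V^*$, is Koszul. That is, $B_0$ is semisimple, $B$ is generated as an algebra by $B_0$ and $B_1$, and, with $B_0$ viewed as the left $B$-module $B/B_{\ge 1}$, the Yoneda algebra $$E(B)=\operatorname{Ext}^{\bullet}_{B}(B_0,B_0)$$ is generated in degree $1$ (as an algebra over its degree-zero part). -/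

import Mathlib

open scoped TensorProduct DirectSum

universe w v u

section ExtAlgebra

open CategoryTheory CategoryTheory.Abelian

variable {C : Type u} [Category.{v} C] [Abelian C] [HasExt.{w} C] (X : C)

/-- The homogeneous elements of the subalgebra of the Yoneda algebra `⨁ n, Ext X X n` that is
generated by the components of degree `0` and degree `1`. -/
inductive InExtSubalgebraGenByDegreeOne : ∀ {n : ℕ}, Ext.{w} X X n → Prop
  | deg_zero (α : Ext.{w} X X 0) : InExtSubalgebraGenByDegreeOne α
  | deg_one (α : Ext.{w} X X 1) : InExtSubalgebraGenByDegreeOne α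
  | zero (n : ℕ) : InExtSubalgebraGenByDegreeOne (0 : Ext.{w} X X n)
  | add {n : ℕ} (α β : Ext.{w} X X n) : InExtSubalgebraGenByDegreeOne α →
      InExtSubalgebraGenByDegreeOne β → InExtSubalgebraGenByDegreeOne (α + β)
  | comp {a b n : ℕ} (α : Ext.{w} X X a) (β : Ext.{w} X X b) (h : a + b = n) :
      InExtSubalgebraGenByDegreeOne α → InExtSubalgebraGenByDegreeOne β →
      InExtSubalgebraGenByDegreeOne (α.comp β h)

/-- The Yoneda algebra `⨁ n, Ext X X n` is generated in degree one
(over its component of degree zero). -/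
def ExtAlgebraGeneratedInDegreeOne : Prop :=
  ∀ (n : ℕ) (α : Ext.{w} X X n), InExtSubalgebraGenByDegreeOne X α

end ExtAlgebra

section Koszul

variable {k : Type v} [CommRing k] {B : Type u} [Ring B] [Algebra k B]
  (ℬ : ℕ → Submodule k B) [GradedAlgebra ℬ]

/-- The degree zero part `B₀` of a graded algebra as a left `B`-module, that is `B / B_{≥ 1}`. -/
abbrev degreeZeroModule : ModuleCat.{u} B :=
  ModuleCat.of B (B ⧸ (HomogeneousIdeal.irrelevant ℬ).toIdeal)

/-- A graded algebra `B = ⨁ d, B_d` is Koszul if `B₀` is semisimple, `B` is generated by `B₀` and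
`B₁`, and the Ext-algebra `Ext_B(B₀, B₀)` is generated in degree one. -/
structure IsKoszulAlgebra : Prop where
  isSemisimpleRing_zero : IsSemisimpleRing (ℬ 0)
  adjoin_zero_one : Algebra.adjoin k ((ℬ 0 : Set B) ∪ (ℬ 1 : Set B)) = ⊤
  ext_generated : ExtAlgebraGeneratedInDegreeOne.{u} (degreeZeroModule ℬ)

end Koszul

section SymGrading

variable (k : Type*) [CommRing k] (M : Type*) [AddCommGroup M] [Module k M]

/-- The symmetric power `S^d M`, as the homogeneous component of degree `d` of `S^• M`. -/
def symPiece (d : ℕ) : Submodule k (SymmetricAlgebra k M) :=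
  LinearMap.range (SymmetricAlgebra.ι k M) ^ d

instance symPiece.gradedMonoid : SetLike.GradedMonoid (symPiece k M) :=
  Submodule.nat_power_gradedMonoid (LinearMap.range (SymmetricAlgebra.ι k M))

theorem symPiece.ι_mem (m : M) : SymmetricAlgebra.ι k M m ∈ symPiece k M 1 := by
  simp [symPiece]

/-- `SymmetricAlgebra.ι` as a map into the direct sum of the symmetric powers. -/
noncomputable def symPiece.ι : M →ₗ[k] ⨁ d, symPiece k M d :=
  DirectSum.lof k ℕ (fun d => symPiece k M d) 1 ∘ₗ
    (SymmetricAlgebra.ι k M).codRestrict _ (symPiece.ι_mem k M)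

theorem symPiece.ι_apply (m : M) : symPiece.ι k M m =
    DirectSum.of (fun d => symPiece k M d) 1 ⟨SymmetricAlgebra.ι k M m, symPiece.ι_mem k M m⟩ :=
  rfl

/-- The symmetric algebra is graded by the symmetric powers. -/
noncomputable instance symPiece.gradedAlgebra : GradedAlgebra (symPiece k M) :=
  GradedAlgebra.ofAlgHom _ (SymmetricAlgebra.lift (symPiece.ι k M))
    (by
      ext m
      simp [symPiece.ι_apply])
    fun i x => by
    obtain ⟨x, hx⟩ := x
    dsimp only [Subtype.coe_mk, DirectSum.lof_eq_of]
    unfold symPiece at hx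
    induction hx using Submodule.pow_induction_on_left' with
    | algebraMap r =>
      rw [AlgHom.commutes, DirectSum.algebraMap_apply]; rfl
    | add x y i hx hy ihx ihy =>
      rw [map_add, ihx, ihy, ← map_add]
      rfl
    | mem_mul m hm i x hx ih =>
      obtain ⟨_, rfl⟩ := hm
      rw [map_mul, ih, SymmetricAlgebra.lift_ι_apply, symPiece.ι_apply, DirectSum.of_mul_of]
      exact DirectSum.of_eq_of_gradedMonoid_eq (Sigma.subtype_ext (add_comm _ _) rfl)

end SymGrading

section McKayAlgebra

variable {k : Type*} [Field k] {G : Type*} [Group G]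
  {V : Type*} [AddCommGroup V] [Module k V] {W : Type*} [AddCommGroup W] [Module k W]

/-- The action of `g` on `S^• V^*` by algebra homomorphisms, induced by the dual representation. -/
noncomputable def symDualAct (ρ : Representation k G V) (g : G) :
    SymmetricAlgebra k (Module.Dual k V) →ₐ[k] SymmetricAlgebra k (Module.Dual k V) :=
  SymmetricAlgebra.lift (SymmetricAlgebra.ι k (Module.Dual k V) ∘ₗ ρ.dual g)

/-- The action `f ↦ σ(g) f σ(g)⁻¹` of `g` on `End(W)` by algebra homomorphisms. -/
def endAct (σ : Representation k G W) (g : G) : Module.End k W →ₐ[k] Module.End k W :=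
  AlgHom.ofLinearMap (Representation.linHom σ σ g)
    (by ext x; simp)
    (fun f f' => by ext x; simp)

variable (k V W) in
/-- The algebra `S^• V^* ⊗ End(W)^op`. -/
abbrev SymTensorEndOp : Type _ :=
  SymmetricAlgebra k (Module.Dual k V) ⊗[k] (Module.End k W)ᵐᵒᵖ

noncomputable instance SymTensorEndOp.instRing : Ring (SymTensorEndOp k V W) :=
  Algebra.TensorProduct.instRing

/-- The diagonal action of `g` on `S^• V^* ⊗ End(W)^op`. -/
noncomputable def symTensorEndOpAct (ρ : Representation k G V) (σ : Representation k G W) (g : G) :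
    SymTensorEndOp k V W →ₐ[k] SymTensorEndOp k V W :=
  Algebra.TensorProduct.map (symDualAct ρ g) (AlgHom.op (endAct σ g))

/-- The algebra of invariants `(S^• V^* ⊗ End(W)^op)^G`. -/
noncomputable def invariantAlgebra (ρ : Representation k G V) (σ : Representation k G W) :
    Subalgebra k (SymTensorEndOp k V W) :=
  ⨅ g : G, AlgHom.equalizer (symTensorEndOpAct ρ σ g) (AlgHom.id k _)

noncomputable instance invariantAlgebra.instRing (ρ : Representation k G V)
    (σ : Representation k G W) : Ring (invariantAlgebra ρ σ) :=
  (invariantAlgebra ρ σ).toRing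

noncomputable instance invariantAlgebra.instAddCommGroup (ρ : Representation k G V)
    (σ : Representation k G W) : AddCommGroup (invariantAlgebra ρ σ) :=
  Ring.toAddCommGroup

theorem mem_invariantAlgebra {ρ : Representation k G V} {σ : Representation k G W}
    {x : SymTensorEndOp k V W} :
    x ∈ invariantAlgebra ρ σ ↔ ∀ g, symTensorEndOpAct ρ σ g x = x := by
  simp [invariantAlgebra, Algebra.mem_iInf, AlgHom.mem_equalizer]

variable (k V W) in
/-- The subspace `S^d V^* ⊗ End(W)^op` of `S^• V^* ⊗ End(W)^op`. -/
noncomputable def symTensorEndOpPiece (d : ℕ) : Submodule k (SymTensorEndOp k V W) :=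
  LinearMap.range ((symPiece k (Module.Dual k V) d).subtype.rTensor (Module.End k W)ᵐᵒᵖ)

/-- The homogeneous component `(S^d V^* ⊗ End(W)^op)^G` of `(S^• V^* ⊗ End(W)^op)^G`. -/
noncomputable def invariantPiece (ρ : Representation k G V) (σ : Representation k G W) (d : ℕ) :
    Submodule k (invariantAlgebra ρ σ) :=
  (symTensorEndOpPiece k V W d).comap (invariantAlgebra ρ σ).val.toLinearMap

theorem tmul_mem_symTensorEndOpPiece {d : ℕ} {s : SymmetricAlgebra k (Module.Dual k V)}
    (hs : s ∈ symPiece k (Module.Dual k V) d) (f : (Module.End k W)ᵐᵒᵖ) :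
    s ⊗ₜ[k] f ∈ symTensorEndOpPiece k V W d :=
  ⟨⟨s, hs⟩ ⊗ₜ f, rfl⟩

theorem symTensorEndOpPiece_le {d : ℕ} {N : Submodule k (SymTensorEndOp k V W)}
    (h : ∀ s ∈ symPiece k (Module.Dual k V) d, ∀ f : (Module.End k W)ᵐᵒᵖ, s ⊗ₜ[k] f ∈ N) :
    symTensorEndOpPiece k V W d ≤ N := by
  rintro _ ⟨y, rfl⟩
  induction y using TensorProduct.induction_on with
  | zero => rw [map_zero]; exact N.zero_mem
  | tmul s f => exact h s s.2 f
  | add a b ha hb => rw [map_add]; exact N.add_mem ha hb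

instance symTensorEndOpPiece.gradedMonoid :
    SetLike.GradedMonoid (symTensorEndOpPiece k V W) where
  one_mem := by
    rw [Algebra.TensorProduct.one_def]
    exact tmul_mem_symTensorEndOpPiece (SetLike.GradedOne.one_mem) _
  mul_mem i j x y hx hy := by
    have h : symTensorEndOpPiece k V W i ≤
        (symTensorEndOpPiece k V W (i + j)).comap (LinearMap.mulRight k y) :=
      symTensorEndOpPiece_le fun s hs f => by
        have h' : symTensorEndOpPiece k V W j ≤
            (symTensorEndOpPiece k V W (i + j)).comap (LinearMap.mulLeft k (s ⊗ₜ[k] f)) :=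
          symTensorEndOpPiece_le fun t ht f' => by
            rw [Submodule.mem_comap, LinearMap.mulLeft_apply, Algebra.TensorProduct.tmul_mul_tmul]
            exact tmul_mem_symTensorEndOpPiece (SetLike.GradedMul.mul_mem hs ht) _
        exact h' hy
    exact h hx

instance invariantPiece.gradedMonoid (ρ : Representation k G V) (σ : Representation k G W) :
    SetLike.GradedMonoid (invariantPiece ρ σ) where
  one_mem := (SetLike.GradedOne.one_mem : (1 : SymTensorEndOp k V W) ∈ symTensorEndOpPiece k V W 0)
  mul_mem _ _ _ _ hx hy :=
    (SetLike.GradedMul.mul_mem (A := symTensorEndOpPiece k V W) hx hy)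

variable (k V W) in
/-- The projection of `S^• V^* ⊗ End(W)^op` onto its component of degree `d`. -/
noncomputable def symTensorEndOpProj (d : ℕ) : SymTensorEndOp k V W →ₗ[k] SymTensorEndOp k V W :=
  (GradedAlgebra.proj (symPiece k (Module.Dual k V)) d).rTensor (Module.End k W)ᵐᵒᵖ

theorem symTensorEndOpProj_mem (d : ℕ) (x : SymTensorEndOp k V W) :
    symTensorEndOpProj k V W d x ∈ symTensorEndOpPiece k V W d := by
  induction x using TensorProduct.induction_on with
  | zero => simp
  | tmul s f =>
    exact tmul_mem_symTensorEndOpPiece (by simp [GradedAlgebra.proj_apply]) f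
  | add a b ha hb => rw [map_add]; exact Submodule.add_mem _ ha hb

theorem symTensorEndOpProj_same {d : ℕ} {x : SymTensorEndOp k V W}
    (hx : x ∈ symTensorEndOpPiece k V W d) : symTensorEndOpProj k V W d x = x := by
  have h : symTensorEndOpPiece k V W d ≤
      LinearMap.eqLocus (symTensorEndOpProj k V W d) LinearMap.id :=
    symTensorEndOpPiece_le fun s hs f => by
      rw [LinearMap.mem_eqLocus, symTensorEndOpProj, LinearMap.rTensor_tmul,
        GradedAlgebra.proj_apply, DirectSum.decompose_of_mem_same _ hs, LinearMap.id_apply]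
  exact h hx

theorem symTensorEndOpProj_ne {d e : ℕ} (h : e ≠ d) {x : SymTensorEndOp k V W}
    (hx : x ∈ symTensorEndOpPiece k V W e) : symTensorEndOpProj k V W d x = 0 := by
  have h : symTensorEndOpPiece k V W e ≤ LinearMap.ker (symTensorEndOpProj k V W d) :=
    symTensorEndOpPiece_le fun s hs f => by
      rw [LinearMap.mem_ker, symTensorEndOpProj, LinearMap.rTensor_tmul,
        GradedAlgebra.proj_apply, DirectSum.decompose_of_mem_ne _ hs h, TensorProduct.zero_tmul]
  exact h hx

theorem symTensorEndOpAct_mem (ρ : Representation k G V) (σ : Representation k G W) (g : G) {d : ℕ}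
    {x : SymTensorEndOp k V W} (hx : x ∈ symTensorEndOpPiece k V W d) :
    symTensorEndOpAct ρ σ g x ∈ symTensorEndOpPiece k V W d := by
  have h : (symPiece k (Module.Dual k V) d).map (symDualAct ρ g).toLinearMap ≤
      symPiece k (Module.Dual k V) d := by
    unfold symPiece
    rw [Submodule.map_pow]
    refine pow_le_pow_left' ?_ d
    rintro _ ⟨_, ⟨m, rfl⟩, rfl⟩
    exact ⟨ρ.dual g m, by simp [symDualAct]⟩
  have h' : symTensorEndOpPiece k V W d ≤
      (symTensorEndOpPiece k V W d).comap (symTensorEndOpAct ρ σ g).toLinearMap :=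
    symTensorEndOpPiece_le fun s hs f => tmul_mem_symTensorEndOpPiece (h ⟨s, hs, rfl⟩) _
  exact h' hx

theorem exists_sum_symTensorEndOpProj (x : SymTensorEndOp k V W) :
    ∃ N, ∀ n ≥ N, ∑ d ∈ Finset.range n, symTensorEndOpProj k V W d x = x := by
  classical
  induction x using TensorProduct.induction_on with
  | zero => exact ⟨0, fun n _ => by simp⟩
  | tmul s f =>
    refine ⟨(DFinsupp.support (DirectSum.decompose (symPiece k (Module.Dual k V)) s)).sup id + 1,
      fun n hn => ?_⟩
    simp only [symTensorEndOpProj, LinearMap.rTensor_tmul, ← TensorProduct.sum_tmul]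
    congr 1
    conv_rhs => rw [← DirectSum.sum_support_decompose (symPiece k (Module.Dual k V)) s]
    symm
    refine Finset.sum_subset (fun i hi => ?_) (fun i _ hi => ?_)
    · have : i ≤ _ := Finset.le_sup (f := id) hi
      exact Finset.mem_range.2 (by omega)
    · simpa using hi
  | add a b ha hb =>
    obtain ⟨N, hN⟩ := ha
    obtain ⟨M, hM⟩ := hb
    refine ⟨max N M, fun n hn => ?_⟩
    simp only [map_add, Finset.sum_add_distrib]
    rw [hN n (le_trans (le_max_left _ _) hn), hM n (le_trans (le_max_right _ _) hn)]

theorem symTensorEndOpAct_proj (ρ : Representation k G V) (σ : Representation k G W) (g : G) (d : ℕ)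
    (x : SymTensorEndOp k V W) :
    symTensorEndOpAct ρ σ g (symTensorEndOpProj k V W d x) =
      symTensorEndOpProj k V W d (symTensorEndOpAct ρ σ g x) := by
  obtain ⟨N, hN⟩ := exists_sum_symTensorEndOpProj x
  have key : ∀ e, symTensorEndOpProj k V W d (symTensorEndOpAct ρ σ g (symTensorEndOpProj k V W e x))
      = if e = d then symTensorEndOpAct ρ σ g (symTensorEndOpProj k V W e x) else 0 := by
    intro e
    have hm := symTensorEndOpAct_mem ρ σ g (symTensorEndOpProj_mem e x)
    split_ifs with h
    · subst h; exact symTensorEndOpProj_same hm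
    · exact symTensorEndOpProj_ne h hm
  conv_rhs => rw [← hN (max N (d + 1)) (le_max_left _ _)]
  simp only [map_sum, key]
  rw [Finset.sum_ite_eq', if_pos]
  exact Finset.mem_range.2 (lt_of_lt_of_le (Nat.lt_succ_self d) (le_max_right _ _))

theorem invariantPiece.isInternal (ρ : Representation k G V) (σ : Representation k G W) :
    DirectSum.IsInternal (invariantPiece ρ σ) := by
  rw [DirectSum.isInternal_submodule_iff_iSupIndep_and_iSup_eq_top]
  constructor
  · intro d
    rw [Submodule.disjoint_def]
    intro x hx hx'
    have h0 : (⨆ (j : ℕ) (_ : j ≠ d), invariantPiece ρ σ j) ≤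
        LinearMap.ker (symTensorEndOpProj k V W d ∘ₗ (invariantAlgebra ρ σ).val.toLinearMap) :=
      iSup₂_le fun j hj y hy => symTensorEndOpProj_ne hj hy
    have h1 : symTensorEndOpProj k V W d x = 0 := h0 hx'
    have h2 : symTensorEndOpProj k V W d x = x := symTensorEndOpProj_same hx
    exact Subtype.ext (h2.symm.trans h1)
  · rw [eq_top_iff]
    rintro x -
    obtain ⟨N, hN⟩ := exists_sum_symTensorEndOpProj (x : SymTensorEndOp k V W)
    let y : ℕ → invariantAlgebra ρ σ := fun d =>
      ⟨symTensorEndOpProj k V W d x, mem_invariantAlgebra.2 fun g => by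
        rw [symTensorEndOpAct_proj, mem_invariantAlgebra.1 x.2 g]⟩
    have hx : x = ∑ d ∈ Finset.range N, y d := by
      apply Subtype.ext
      rw [← hN N le_rfl]
      simp [y]
    rw [hx]
    exact Submodule.sum_mem _ fun d _ => Submodule.mem_iSup_of_mem d (symTensorEndOpProj_mem d _)

/-- `(S^• V^* ⊗ End(W)^op)^G` is graded by the degree in `S^• V^*`. -/
noncomputable instance invariantPiece.gradedAlgebra
    (ρ : Representation k G V) (σ : Representation k G W) :
    GradedAlgebra (invariantPiece ρ σ) where
  __ := invariantPiece.gradedMonoid ρ σ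
  __ := (invariantPiece.isInternal ρ σ).chooseDecomposition

end McKayAlgebra

/-- The family `σ i` contains every irreducible representation of the finite group `G` over `ℂ`
exactly once up to isomorphism. As every irreducible representation of a finite group is
finite-dimensional, it suffices to test on representations in the smallest universe. -/
structure IsCompleteIrreducibleFamily {G : Type*} [Group G] {ι : Type*}
    {U : ι → Type*} [∀ i, AddCommGroup (U i)] [∀ i, Module ℂ (U i)]
    (σ : ∀ i, Representation ℂ G (U i)) : Prop where
  irreducible : ∀ i, (σ i).IsIrreducible
  pairwise_not_equiv : ∀ i j, Nonempty ((σ i).Equiv (σ j)) → i = j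
  complete : ∀ (M : Type) [AddCommGroup M] [Module ℂ M] (τ : Representation ℂ G M),
    τ.IsIrreducible → ∃ i, Nonempty (τ.Equiv (σ i))

/-!
Write `A = S^• V^* ⊗ End(W)^op`, `L = V^*`, `B = A^G` and `J = B_{≥ 1}`. The proof produces a linear
projective resolution of `B ⧸ J` and reads off the generation of the Yoneda algebra from it.

The resolution is the `G`-invariant part of the Koszul complex `A ⊗ ⋀^n L`, whose differential
`koszulDiff` multiplies by a coordinate and contracts with the dual basis. The de Rham operator
`deRhamDiff` is a contracting homotopy up to the total degree
(`IsPartialDerivatives.homotopy`), and averaging over `G` preserves exactness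
(`IsEquivariantSystem.exists_invariant_koszulDiff_eq`). The terms `(A ⊗ ⋀^n L)^G` are finitely
generated projective over `B` because `W` contains every irreducible representation: the
representation `W ⊗ ⋀ L` is a direct summand of some `W^n`
(`IsCompleteIrreducibleFamily.exists_sum_comp_eq_id`), and the intertwining maps that exhibit it as
such are the elements of a `G`-invariant dual basis of `A ⊗ ⋀ L` which is concentrated in degree
zero of `A` (`invariantDualBasis`).

Let `P = (A ⊗ ⋀^n L)^G`, let `Z` be the submodule of Koszul cycles, which sit in positive degree of
`A` (as a condition for `n = 0`, automatically for `n > 0`), and let `F` be the part of `P` of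
positive degree in `A`. The dual basis gives `F = J P`, so `P ⧸ F` is a direct summand of a power of
`B ⧸ J`. Every element of `Z` of degree at least two in `A` lies in `J Z`, again by the dual basis;
as `B₀` is semisimple, it follows that every `B`-linear map `Z → B ⧸ J` extends to `F`
(`exists_extension_to_positiveForms`). Hence the connecting map
`Ext^m(Z, B ⧸ J) → Ext^{m+1}(P ⧸ Z, B ⧸ J)` is given on products `f · β`, with `f : Z → B ⧸ J`, by
the pullback to `P ⧸ Z` of the class of an extension of `P ⧸ F` by `B ⧸ J`, that is by elements of
`Ext^1(B ⧸ J, B ⧸ J)`. As `P ⧸ Z` is `B ⧸ J` for `n = 0` and the previous module of cycles for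
`n > 0`, induction along the resolution shows that `Ext(B ⧸ J, B ⧸ J)` is generated in degree one
(`extSpannedByDegreeOne_succ_of_dualBasis`). The same dual basis writes an invariant of degree
`m + 1` as a sum of products of invariants of degrees `m` and `1` (`adjoin_zero_one_eq_top`).
Finally `B₀` is the opposite of the endomorphism algebra of the semisimple representation `W`.
-/

/-! ### Generation of Ext groups in degree one -/

section ExtGeneration

open CategoryTheory CategoryTheory.Abelian

variable {C : Type u} [Category.{v} C] [Abelian C] [HasExt.{w} C]

/-- `Ext M X n` is spanned by the products `g · β` of a morphism `g : M ⟶ X` with an element `β`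
of degree `n` of the subalgebra of the Yoneda algebra of `X` generated in degrees `0` and `1`. -/
def ExtSpannedByDegreeOne (X M : C) (n : ℕ) : Prop :=
  ∀ α : Ext.{w} M X n, α ∈ AddSubgroup.closure
    {γ | ∃ (g : M ⟶ X) (β : Ext.{w} X X n), InExtSubalgebraGenByDegreeOne X β ∧
      γ = (Ext.mk₀ g).comp β (zero_add n)}

theorem extSpannedByDegreeOne_zero (X M : C) : ExtSpannedByDegreeOne.{w} X M 0 := by
  intro α
  refine AddSubgroup.subset_closure ⟨Ext.homEquiv₀ α, Ext.mk₀ (𝟙 X), .deg_zero _, ?_⟩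
  simp

/-- A spanning statement for `X` itself says that the Yoneda algebra is generated in degree one. -/
theorem ExtSpannedByDegreeOne.inExtSubalgebra {X : C} {n : ℕ}
    (h : ExtSpannedByDegreeOne.{w} X X n) (α : Ext.{w} X X n) :
    InExtSubalgebraGenByDegreeOne X α := by
  have neg : ∀ {β : Ext.{w} X X n}, InExtSubalgebraGenByDegreeOne X β →
      InExtSubalgebraGenByDegreeOne X (-β) := by
    intro β hβ
    have : -β = (-Ext.mk₀ (𝟙 X)).comp β (zero_add n) := by simp
    rw [this]
    exact .comp _ _ _ (.deg_zero _) hβ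
  induction h α using AddSubgroup.closure_induction with
  | mem γ hγ =>
    obtain ⟨g, β, hβ, rfl⟩ := hγ
    exact .comp _ _ _ (.deg_zero _) hβ
  | zero => exact .zero n
  | add a b _ _ ha hb => exact .add _ _ ha hb
  | neg a _ ha => exact neg ha

/-- Dimension shifting along a short exact sequence `S` with projective middle term. If `S` maps to
`T` so that all maps `S.X₁ ⟶ X` factor through `T.X₁`, the connecting map can be computed with the
extension class of `T`. If moreover the identity of `T.X₃` factors through copies of `X`, the
resulting classes are products with elements of `Ext X X 1`. -/
theorem ExtSpannedByDegreeOne.succ {S T : ShortComplex C} (hS : S.ShortExact)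
    (hT : T.ShortExact) [Projective S.X₂] (φ : S ⟶ T) (X : C)
    (hext : ∀ f : S.X₁ ⟶ X, ∃ f' : T.X₁ ⟶ X, φ.τ₁ ≫ f' = f)
    {κ : Type*} [Fintype κ] (p : κ → (T.X₃ ⟶ X)) (i : κ → (X ⟶ T.X₃))
    (hpi : ∑ j, p j ≫ i j = 𝟙 T.X₃) {n : ℕ} (h : ExtSpannedByDegreeOne.{w} X S.X₁ n) :
    ExtSpannedByDegreeOne.{w} X S.X₃ (n + 1) := by
  intro α
  obtain ⟨α', rfl⟩ := Ext.contravariant_sequence_exact₃ hS X α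
    (Ext.eq_zero_of_projective _) (add_comm 1 n)
  induction h α' using AddSubgroup.closure_induction with
  | mem γ hγ =>
    obtain ⟨f, β, hβ, rfl⟩ := hγ
    obtain ⟨f', rfl⟩ := hext f
    -- Push the extension class forward along `φ.τ₁` and pull it back along `φ.τ₃`.
    have key : hS.extClass.comp ((Ext.mk₀ (φ.τ₁ ≫ f')).comp β (zero_add n)) (add_comm 1 n) =
        ∑ j, (Ext.mk₀ (φ.τ₃ ≫ p j)).comp
          (((Ext.mk₀ (i j)).comp (hT.extClass.comp (Ext.mk₀ f') (add_zero 1)) (zero_add 1)).comp β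
            (add_comm 1 n)) (zero_add (n + 1)) := by
      have h1 : (Ext.mk₀ φ.τ₃).comp hT.extClass (zero_add 1) =
          ∑ j, (Ext.mk₀ (φ.τ₃ ≫ p j)).comp
            ((Ext.mk₀ (i j)).comp hT.extClass (zero_add 1)) (zero_add 1) := by
        conv_lhs => rw [← Category.comp_id φ.τ₃, ← hpi, Preadditive.comp_sum]
        rw [Ext.mk₀_sum, Ext.sum_comp]
        refine Finset.sum_congr rfl fun j _ => ?_
        rw [← Category.assoc, ← Ext.mk₀_comp_mk₀, Ext.mk₀_comp_mk₀_assoc]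
        simp
      rw [← Ext.mk₀_comp_mk₀]
      rw [← Ext.comp_assoc (a₁₂ := 1) _ _ _ (by lia) (by lia) (by lia),
        ← Ext.comp_assoc (a₁₂ := 1) _ _ _ (by lia) (by lia) (by lia),
        ShortComplex.ShortExact.extClass_naturality hS hT φ, h1, Ext.sum_comp, Ext.sum_comp]
      refine Finset.sum_congr rfl fun j _ => ?_
      rw [Ext.comp_assoc_of_third_deg_zero, Ext.comp_assoc_of_third_deg_zero,
        Ext.comp_assoc (a₁₂ := 1) (a₂₃ := n + 1) _ _ _ (by lia) (by lia) (by lia)]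
    rw [key]
    exact AddSubgroup.sum_mem _ fun j _ => AddSubgroup.subset_closure
      ⟨_, _, .comp _ _ _ (.deg_one _) hβ, rfl⟩
  | zero => simp
  | add a b _ _ ha hb => rw [Ext.comp_add]; exact add_mem ha hb
  | neg a _ ha => rw [Ext.comp_neg]; exact neg_mem ha

end ExtGeneration

/-! ### Dimension shifting for modules over a ring -/

section ExtGenerationModule

open CategoryTheory CategoryTheory.Abelian

variable {B : Type u} [Ring B] {M' P M X : Type u} [AddCommGroup M'] [Module B M']
  [AddCommGroup P] [Module B P] [AddCommGroup M] [Module B M] [AddCommGroup X] [Module B X]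

/-- `ExtSpannedByDegreeOne.succ` for modules, where `T` is the sequence `F → P → P ⧸ F` of a
submodule `F` of `P` containing the image of `M'`. -/
theorem extSpannedByDegreeOne_succ_of_exact [Module.Projective B P] (i : M' →ₗ[B] P)
    (q : P →ₗ[B] M) (hi : Function.Injective i) (hq : Function.Surjective q)
    (hex : Function.Exact i q) (F : Submodule B P) (hF : ∀ x, i x ∈ F)
    (hext : ∀ f : M' →ₗ[B] X, ∃ f' : F →ₗ[B] X, ∀ x, f' ⟨i x, hF x⟩ = f x)
    {κ : Type*} [Fintype κ] (p : κ → P →ₗ[B] X) (hp : ∀ j, F ≤ LinearMap.ker (p j))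
    (r : κ → X →ₗ[B] P ⧸ F) (hpr : ∀ x, ∑ j, r j (p j x) = F.mkQ x) {n : ℕ}
    (h : ExtSpannedByDegreeOne.{u} (ModuleCat.of B X) (ModuleCat.of B M') n) :
    ExtSpannedByDegreeOne.{u} (ModuleCat.of B X) (ModuleCat.of B M) (n + 1) := by
  let S : ShortComplex (ModuleCat.{u} B) :=
    ShortComplex.mk (ModuleCat.ofHom i) (ModuleCat.ofHom q) (by
      ext x; exact hex.apply_apply_eq_zero x)
  let T : ShortComplex (ModuleCat.{u} B) :=
    ShortComplex.mk (ModuleCat.ofHom F.subtype) (ModuleCat.ofHom F.mkQ) (by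
      ext x; simp)
  have hS : S.ShortExact :=
    { exact := (ShortComplex.ShortExact.moduleCat_exact_iff_function_exact S).2 hex
      mono_f := (ModuleCat.mono_iff_injective _).2 hi
      epi_g := (ModuleCat.epi_iff_surjective _).2 hq }
  have hT : T.ShortExact :=
    { exact := (ShortComplex.ShortExact.moduleCat_exact_iff_function_exact T).2
        (LinearMap.exact_subtype_mkQ F)
      mono_f := (ModuleCat.mono_iff_injective _).2 F.subtype_injective
      epi_g := (ModuleCat.epi_iff_surjective _).2 F.mkQ_surjective }
  have : Projective S.X₂ := (IsProjective.iff_projective P).1 inferInstance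
  have hker : LinearMap.ker q ≤ LinearMap.ker F.mkQ := by
    intro x hx
    obtain ⟨y, rfl⟩ := (hex x).1 hx
    simpa using hF y
  let t : M →ₗ[B] P ⧸ F :=
    (LinearMap.ker q).liftQ F.mkQ hker ∘ₗ (q.quotKerEquivOfSurjective hq).symm.toLinearMap
  have ht : ∀ x, t (q x) = F.mkQ x := by
    intro x
    have : (q.quotKerEquivOfSurjective hq).symm (q x) = (LinearMap.ker q).mkQ x := by
      rw [LinearEquiv.symm_apply_eq]; rfl
    simp [t, this]
  let φ : S ⟶ T :=
    { τ₁ := ModuleCat.ofHom (i.codRestrict F hF)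
      τ₂ := 𝟙 _
      τ₃ := ModuleCat.ofHom t
      comm₁₂ := by ext x; rfl
      comm₂₃ := by ext x; exact (ht x).symm }
  refine ExtSpannedByDegreeOne.succ hS hT φ (ModuleCat.of B X) ?_
    (fun j => ModuleCat.ofHom (F.liftQ (p j) (hp j))) (fun j => ModuleCat.ofHom (r j)) ?_ h
  · intro f
    obtain ⟨f', hf'⟩ := hext f.hom
    exact ⟨ModuleCat.ofHom f', by ext x; exact hf' x⟩
  · ext x
    refine Eq.trans ?_ (hpr x)
    rw [ModuleCat.hom_sum]
    simp

theorem projective_of_dualBasis {κ : Type*} [Fintype κ] (v : κ → P →ₗ[B] B) (w : κ → P)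
    (hvw : ∀ y, ∑ j, v j y • w j = y) : Module.Projective B P := by
  refine Module.Projective.of_split (M := κ → B) (LinearMap.pi v)
    (∑ j, (LinearMap.toSpanSingleton B _ (w j)) ∘ₗ LinearMap.proj j) ?_
  ext1 y
  simpa using hvw y

/-- The inductive step along a linear projective resolution. The module `P` is finitely generated
projective with dual basis `v`, `w`, and `F` is the submodule `J P`. The class of the extension of
`M` by `M'` becomes, after pushing out to `F`, a pullback of the extension of `P ⧸ F` by `F`, and
`P ⧸ F` is a direct summand of a power of `B ⧸ J`. -/
theorem extSpannedByDegreeOne_succ_of_dualBasis (J : Ideal B) (i : M' →ₗ[B] P)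
    (q : P →ₗ[B] M) (hi : Function.Injective i) (hq : Function.Surjective q)
    (hex : Function.Exact i q) (F : Submodule B P) (hF : ∀ x, i x ∈ F)
    (hext : ∀ f : M' →ₗ[B] B ⧸ J, ∃ f' : F →ₗ[B] B ⧸ J, ∀ x, f' ⟨i x, hF x⟩ = f x)
    {κ : Type*} [Fintype κ] (v : κ → P →ₗ[B] B) (w : κ → P) (hvw : ∀ y, ∑ j, v j y • w j = y)
    (hv : ∀ j, ∀ y ∈ F, v j y ∈ J) (hw : ∀ j, ∀ c ∈ J, c • w j ∈ F) {n : ℕ}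
    (h : ExtSpannedByDegreeOne.{u} (ModuleCat.of B (B ⧸ J)) (ModuleCat.of B M') n) :
    ExtSpannedByDegreeOne.{u} (ModuleCat.of B (B ⧸ J)) (ModuleCat.of B M) (n + 1) := by
  have := projective_of_dualBasis v w hvw
  refine extSpannedByDegreeOne_succ_of_exact i q hi hq hex F hF hext (fun j => J.mkQ ∘ₗ v j)
    (fun j y hy => ?_)
    (fun j => J.liftQ (LinearMap.toSpanSingleton B _ (F.mkQ (w j))) fun c hc => ?_) (fun y => ?_) h
  · rw [LinearMap.mem_ker, LinearMap.comp_apply, Submodule.mkQ_apply, Submodule.Quotient.mk_eq_zero]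
    exact hv j y hy
  · rw [LinearMap.mem_ker, LinearMap.toSpanSingleton_apply, ← map_smul, Submodule.mkQ_apply,
      Submodule.Quotient.mk_eq_zero]
    exact hw j c hc
  · conv_rhs => rw [← hvw y, map_sum]
    exact Finset.sum_congr rfl fun j _ => by simp

end ExtGenerationModule

/-! ### Contractions of the exterior algebra -/

section ExteriorContraction

variable {k : Type*} [Field k] {L : Type*} [AddCommGroup L] [Module k L]

open CliffordAlgebra (contractLeft)

/-- Contraction lowers the exterior degree by one. The second part makes up for the truncated
subtraction in degree zero. -/
theorem contractLeft_mem_exteriorPower (φ : Module.Dual k L) {n : ℕ} {ω : ExteriorAlgebra k L}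
    (hω : ω ∈ ⋀[k]^n L) :
    contractLeft (Q := (0 : QuadraticForm k L)) φ ω ∈ ⋀[k]^(n - 1) L ∧
      (n = 0 → contractLeft (Q := (0 : QuadraticForm k L)) φ ω = 0) := by
  induction hω using Submodule.pow_induction_on_left' with
  | algebraMap r =>
    have : contractLeft (Q := (0 : QuadraticForm k L)) φ (algebraMap k _ r) = 0 :=
      CliffordAlgebra.contractLeft_algebraMap _ φ r
    exact ⟨this ▸ zero_mem _, fun _ => this⟩
  | add x y i hx hy ihx ihy =>
    refine ⟨?_, fun h => ?_⟩
    · rw [map_add]; exact add_mem ihx.1 ihy.1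
    · rw [map_add, ihx.2 h, ihy.2 h, add_zero]
  | mem_mul m hm i x hx ih =>
    obtain ⟨l, rfl⟩ := hm
    refine ⟨?_, fun h => by omega⟩
    have h1 : contractLeft (Q := (0 : QuadraticForm k L)) φ (ExteriorAlgebra.ι k l * x) =
        φ l • x - ExteriorAlgebra.ι k l * contractLeft (Q := (0 : QuadraticForm k L)) φ x :=
      CliffordAlgebra.contractLeft_ι_mul φ l x
    rw [h1]
    refine sub_mem (Submodule.smul_mem _ _ hx) ?_
    rcases i with _ | i
    · rw [ih.2 rfl, mul_zero]; exact zero_mem _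
    · have : ExteriorAlgebra.ι k l * contractLeft (Q := (0 : QuadraticForm k L)) φ x ∈
          ⋀[k]^(1 + i) L :=
        SetLike.GradedMul.mul_mem (A := fun i : ℕ => ⋀[k]^i L) (i := 1)
          (by simp) ih.1
      rwa [add_comm] at this

variable {I : Type*} [Fintype I] (b : Module.Basis I k L)

/-- The operator `∑ i, bᵢ ∧ (bᵢ^* ⌟ ·)` counts the degree in the exterior algebra. -/
theorem sum_ι_mul_contractLeft {n : ℕ} {ω : ExteriorAlgebra k L} (hω : ω ∈ ⋀[k]^n L) :
    ∑ i, ExteriorAlgebra.ι k (b i) *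
      contractLeft (Q := (0 : QuadraticForm k L)) (b.coord i) ω = (n : k) • ω := by
  induction hω using Submodule.pow_induction_on_left' with
  | algebraMap r =>
    have : ∀ φ, contractLeft (Q := (0 : QuadraticForm k L)) φ (algebraMap k _ r) = 0 :=
      fun φ => CliffordAlgebra.contractLeft_algebraMap _ φ r
    simp [this]
  | add x y i hx hy ihx ihy =>
    simp only [map_add, mul_add, Finset.sum_add_distrib, ihx, ihy, smul_add]
  | mem_mul m hm n x hx ih =>
    obtain ⟨l, rfl⟩ := hm
    have h1 : ∀ φ, contractLeft (Q := (0 : QuadraticForm k L)) φ (ExteriorAlgebra.ι k l * x) =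
        φ l • x - ExteriorAlgebra.ι k l * contractLeft (Q := (0 : QuadraticForm k L)) φ x :=
      fun φ => CliffordAlgebra.contractLeft_ι_mul φ l x
    have h2 : ∀ (l' : L) (y : ExteriorAlgebra k L), ExteriorAlgebra.ι k l' *
        (ExteriorAlgebra.ι k l * y) = - (ExteriorAlgebra.ι k l * (ExteriorAlgebra.ι k l' * y)) := by
      intro l' y
      rw [← mul_assoc, ← mul_assoc, ← neg_mul]
      congr 1
      exact eq_neg_of_add_eq_zero_left (ExteriorAlgebra.ι_add_mul_swap l' l)
    have h3 : ∑ i, b.coord i l • ExteriorAlgebra.ι k (b i) = ExteriorAlgebra.ι k l := by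
      conv_rhs => rw [← b.sum_repr l, map_sum]
      simp
    simp only [h1, mul_sub, h2, sub_neg_eq_add, Finset.sum_add_distrib, ← Finset.mul_sum, ih]
    have h4 : ∑ i, ExteriorAlgebra.ι k (b i) * b.coord i l • x = ExteriorAlgebra.ι k l * x := by
      rw [← h3, Finset.sum_mul]
      simp
    rw [h4, mul_smul_comm]
    push_cast
    module

end ExteriorContraction

/-! ### The Koszul and de Rham differentials -/

section KoszulComplex

variable {k : Type*} [Field k] {A : Type*} [Ring A] [Algebra k A]
  {L : Type*} [AddCommGroup L] [Module k L] {I : Type*} [Fintype I]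

open CliffordAlgebra (contractLeft)

/-- The Koszul differential `a ⊗ ω ↦ ∑ i, a x(bᵢ) ⊗ (bᵢ^* ⌟ ω)` of a linear map `x : L → A`. It is
defined on the whole of `A ⊗ ⋀ L` and lowers the exterior degree by one. -/
noncomputable def koszulDiff (x : L →ₗ[k] A) (b : Module.Basis I k L) :
    A ⊗[k] ExteriorAlgebra k L →ₗ[A] A ⊗[k] ExteriorAlgebra k L :=
  ∑ i, TensorProduct.AlgebraTensorModule.map (LinearMap.toSpanSingleton A A (x (b i)))
    (contractLeft (Q := (0 : QuadraticForm k L)) (b.coord i))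

/-- The operator `a ⊗ ω ↦ ∑ i, Dᵢ a ⊗ (bᵢ ∧ ω)`. When the `Dᵢ` are partial derivatives this is the
algebraic de Rham differential. -/
noncomputable def deRhamDiff (D : I → A →ₗ[k] A) (b : Module.Basis I k L) :
    A ⊗[k] ExteriorAlgebra k L →ₗ[k] A ⊗[k] ExteriorAlgebra k L :=
  ∑ i, TensorProduct.map (D i) (LinearMap.mulLeft k (ExteriorAlgebra.ι k (b i)))

theorem koszulDiff_tmul (x : L →ₗ[k] A) (b : Module.Basis I k L) (a : A)
    (ω : ExteriorAlgebra k L) : koszulDiff x b (a ⊗ₜ ω) = ∑ i, (a * x (b i)) ⊗ₜ[k]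
      contractLeft (Q := (0 : QuadraticForm k L)) (b.coord i) ω := by
  simp [koszulDiff, LinearMap.sum_apply]

theorem deRhamDiff_tmul (D : I → A →ₗ[k] A) (b : Module.Basis I k L) (a : A)
    (ω : ExteriorAlgebra k L) : deRhamDiff D b (a ⊗ₜ ω) =
      ∑ i, D i a ⊗ₜ[k] (ExteriorAlgebra.ι k (b i) * ω) := by
  simp [deRhamDiff, LinearMap.sum_apply]

/-- The `i`-th operator `D i` differentiates with respect to the degree-one element `x (b i)` of the
graded algebra `A`, the elements `x (b i)` commute with each other, and Euler's identity holds. -/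
structure IsPartialDerivatives (𝒜 : ℕ → Submodule k A) (x : L →ₗ[k] A) (b : Module.Basis I k L)
    (D : I → A →ₗ[k] A) : Prop where
  mem_one : ∀ l, x l ∈ 𝒜 1
  comm : ∀ l l', x l * x l' = x l' * x l
  apply_mul_self : ∀ i a, D i (a * x (b i)) = D i a * x (b i) + a
  apply_mul_ne : ∀ i j a, i ≠ j → D i (a * x (b j)) = D i a * x (b j)
  euler : ∀ m, ∀ a ∈ 𝒜 m, ∑ i, D i a * x (b i) = (m : k) • a

variable {𝒜 : ℕ → Submodule k A} {x : L →ₗ[k] A} {b : Module.Basis I k L} {D : I → A →ₗ[k] A}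

/-- On forms of bidegree `(m, n)` the anticommutator of the Koszul and the de Rham differential is
multiplication by the total degree `m + n`. -/
theorem IsPartialDerivatives.homotopy (h : IsPartialDerivatives 𝒜 x b D) {m n : ℕ} {a : A}
    (ha : a ∈ 𝒜 m) {ω : ExteriorAlgebra k L} (hω : ω ∈ ⋀[k]^n L) :
    koszulDiff x b (deRhamDiff D b (a ⊗ₜ ω)) + deRhamDiff D b (koszulDiff x b (a ⊗ₜ ω)) =
      ((m + n : ℕ) : k) • (a ⊗ₜ[k] ω) := by
  classical
  have h1 : ∀ i j, contractLeft (Q := (0 : QuadraticForm k L)) (b.coord j)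
      (ExteriorAlgebra.ι k (b i) * ω) = (if i = j then ω else 0) -
        ExteriorAlgebra.ι k (b i) *
          contractLeft (Q := (0 : QuadraticForm k L)) (b.coord j) ω := by
    intro i j
    refine (CliffordAlgebra.contractLeft_ι_mul _ _ _).trans ?_
    congr 1
    rw [Module.Basis.coord_apply, Module.Basis.repr_self, Finsupp.single_apply]
    split_ifs <;> simp
  have h2 : ∀ i j, D i (a * x (b j)) = D i a * x (b j) + if i = j then a else 0 := by
    intro i j
    split_ifs with hij
    · subst hij; exact h.apply_mul_self i a
    · rw [h.apply_mul_ne i j a hij, add_zero]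
  rw [deRhamDiff_tmul, koszulDiff_tmul, map_sum, map_sum]
  simp only [koszulDiff_tmul, deRhamDiff_tmul, h1, h2, TensorProduct.tmul_sub,
    TensorProduct.add_tmul, Finset.sum_sub_distrib, Finset.sum_add_distrib]
  rw [Finset.sum_comm (f := fun i j => (D i a * x (b j)) ⊗ₜ[k] (ExteriorAlgebra.ι k (b i) *
          contractLeft (Q := (0 : QuadraticForm k L)) (b.coord j) ω))]
  have h3 : ∀ i j, (D i a * x (b j)) ⊗ₜ[k] (if i = j then ω else 0) =
      if i = j then (D i a * x (b j)) ⊗ₜ[k] ω else 0 := by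
    intro i j; split_ifs <;> simp
  have h4 : ∀ i j, (if i = j then a else 0) ⊗ₜ[k] (ExteriorAlgebra.ι k (b i) *
      contractLeft (Q := (0 : QuadraticForm k L)) (b.coord j) ω) =
      if i = j then a ⊗ₜ[k] (ExteriorAlgebra.ι k (b i) *
      contractLeft (Q := (0 : QuadraticForm k L)) (b.coord j) ω) else 0 := by
    intro i j; split_ifs <;> simp
  simp only [h3, h4, Finset.sum_ite_eq, Finset.sum_ite_eq', Finset.mem_univ, if_true]
  rw [← TensorProduct.sum_tmul, ← TensorProduct.tmul_sum, h.euler m a ha,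
    sum_ι_mul_contractLeft b hω]
  rw [Nat.cast_add, add_smul, TensorProduct.tmul_smul, ← TensorProduct.smul_tmul']
  abel

theorem koszulDiff_koszulDiff (hx : ∀ l l', x l * x l' = x l' * x l)
    (y : A ⊗[k] ExteriorAlgebra k L) : koszulDiff x b (koszulDiff x b y) = 0 := by
  induction y using TensorProduct.induction_on with
  | zero => simp
  | add y z hy hz => simp [hy, hz]
  | tmul a ω =>
    have h0 : ∀ i, contractLeft (Q := (0 : QuadraticForm k L)) (b.coord i)
        (contractLeft (Q := (0 : QuadraticForm k L)) (b.coord i) ω) = 0 :=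
      fun i => CliffordAlgebra.contractLeft_contractLeft _ _
    have h1 : ∀ i j, contractLeft (Q := (0 : QuadraticForm k L)) (b.coord i)
        (contractLeft (Q := (0 : QuadraticForm k L)) (b.coord j) ω) =
        -contractLeft (Q := (0 : QuadraticForm k L)) (b.coord j)
        (contractLeft (Q := (0 : QuadraticForm k L)) (b.coord i) ω) :=
      fun i j => CliffordAlgebra.contractLeft_comm _ _ _
    simp only [koszulDiff_tmul, map_sum]
    rw [← Finset.sum_product']
    -- The summands cancel in pairs: the `x (b i)` commute and the contractions anticommute.
    refine Finset.sum_involution (fun p _ => (p.2, p.1)) (fun p _ => ?_) (fun p _ hp => ?_)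
      (fun p _ => Finset.mem_univ _) (fun p _ => rfl)
    · rw [h1 p.2 p.1, mul_assoc, hx, ← mul_assoc, TensorProduct.tmul_neg, neg_add_cancel]
    · intro heq
      apply hp
      have : p.2 = p.1 := congrArg Prod.fst heq
      rw [this, h0, TensorProduct.tmul_zero]

end KoszulComplex

/-! ### Bigrading and exactness of the Koszul complex -/

section KoszulGrading

variable {k : Type*} [Field k] {A : Type*} [Ring A] [Algebra k A]
  {L : Type*} [AddCommGroup L] [Module k L] {I : Type*} [Fintype I]

open CliffordAlgebra (contractLeft)

variable (L) in
/-- The projection of `A ⊗ ⋀ L` onto `𝒜 m ⊗ ⋀ L`. -/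
noncomputable def coeffProj (𝒜 : ℕ → Submodule k A) [GradedAlgebra 𝒜] (m : ℕ) :
    A ⊗[k] ExteriorAlgebra k L →ₗ[k] A ⊗[k] ExteriorAlgebra k L :=
  (GradedAlgebra.proj 𝒜 m).rTensor _

variable (k A L) in
/-- The projection of `A ⊗ ⋀ L` onto `A ⊗ ⋀^n L`. -/
noncomputable def formProj (n : ℕ) :
    A ⊗[k] ExteriorAlgebra k L →ₗ[A] A ⊗[k] ExteriorAlgebra k L :=
  (GradedAlgebra.proj (fun n : ℕ => ⋀[k]^n L) n).baseChange A

variable (𝒜 : ℕ → Submodule k A) [GradedAlgebra 𝒜]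

@[simp]
theorem coeffProj_tmul (m : ℕ) (a : A) (ω : ExteriorAlgebra k L) :
    coeffProj L 𝒜 m (a ⊗ₜ ω) = GradedAlgebra.proj 𝒜 m a ⊗ₜ[k] ω := rfl

@[simp]
theorem formProj_tmul (n : ℕ) (a : A) (ω : ExteriorAlgebra k L) :
    formProj k A L n (a ⊗ₜ ω) = a ⊗ₜ[k] GradedAlgebra.proj (fun n : ℕ => ⋀[k]^n L) n ω := rfl

theorem coeffProj_formProj (m n : ℕ) (y : A ⊗[k] ExteriorAlgebra k L) :
    coeffProj L 𝒜 m (formProj k A L n y) = formProj k A L n (coeffProj L 𝒜 m y) := by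
  induction y using TensorProduct.induction_on with
  | zero => simp
  | add y z hy hz => simp only [map_add, hy, hz]
  | tmul a ω => simp

theorem GradedAlgebra.proj_proj {R : Type*} [Ring R] [Algebra k R] (ℛ : ℕ → Submodule k R)
    [GradedAlgebra ℛ] (m n : ℕ) (r : R) : GradedAlgebra.proj ℛ m (GradedAlgebra.proj ℛ n r) =
      if m = n then GradedAlgebra.proj ℛ n r else 0 := by
  simp only [GradedAlgebra.proj_apply]
  split_ifs with h
  · subst h; exact DirectSum.decompose_of_mem_same _ (SetLike.coe_mem _)
  · exact DirectSum.decompose_of_mem_ne _ (SetLike.coe_mem _) (Ne.symm h)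

theorem coeffProj_coeffProj (m n : ℕ) (y : A ⊗[k] ExteriorAlgebra k L) :
    coeffProj L 𝒜 m (coeffProj L 𝒜 n y) = if m = n then coeffProj L 𝒜 n y else 0 := by
  induction y using TensorProduct.induction_on with
  | zero => simp
  | add y z hy hz => simp only [map_add, hy, hz]; split_ifs <;> simp
  | tmul a ω => simp only [coeffProj_tmul, GradedAlgebra.proj_proj]; split_ifs <;> simp

theorem formProj_formProj (n : ℕ) (y : A ⊗[k] ExteriorAlgebra k L) :
    formProj k A L n (formProj k A L n y) = formProj k A L n y := by
  induction y using TensorProduct.induction_on with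
  | zero => simp
  | add y z hy hz => simp only [map_add, hy, hz]
  | tmul a ω => simp only [formProj_tmul, GradedAlgebra.proj_proj, if_true]

theorem GradedAlgebra.exists_sum_proj {R : Type*} [Ring R] [Algebra k R] (ℛ : ℕ → Submodule k R)
    [GradedAlgebra ℛ] (r : R) :
    ∃ N, ∀ n ≥ N, ∑ d ∈ Finset.range n, GradedAlgebra.proj ℛ d r = r := by
  classical
  refine ⟨(DFinsupp.support (DirectSum.decompose ℛ r)).sup id + 1, fun n hn => ?_⟩
  conv_rhs => rw [← DirectSum.sum_support_decompose ℛ r]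
  symm
  refine Finset.sum_subset (fun i hi => ?_) (fun i _ hi => ?_)
  · have : i ≤ _ := Finset.le_sup (f := id) hi
    exact Finset.mem_range.2 (by omega)
  · simpa using hi

theorem exists_sum_coeffProj (y : A ⊗[k] ExteriorAlgebra k L) :
    ∃ N, ∀ n ≥ N, ∑ d ∈ Finset.range n, coeffProj L 𝒜 d y = y := by
  induction y using TensorProduct.induction_on with
  | zero => exact ⟨0, by simp⟩
  | add y z hy hz =>
    obtain ⟨N, hN⟩ := hy
    obtain ⟨M, hM⟩ := hz
    refine ⟨max N M, fun n hn => ?_⟩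
    simp only [map_add, Finset.sum_add_distrib]
    rw [hN n (le_trans (le_max_left _ _) hn), hM n (le_trans (le_max_right _ _) hn)]
  | tmul a ω =>
    obtain ⟨N, hN⟩ := GradedAlgebra.exists_sum_proj 𝒜 a
    exact ⟨N, fun n hn => by simp only [coeffProj_tmul, ← TensorProduct.sum_tmul, hN n hn]⟩

variable {𝒜} {x : L →ₗ[k] A} {b : Module.Basis I k L} {D : I → A →ₗ[k] A}

theorem koszulDiff_coeffProj (hx : ∀ l, x l ∈ 𝒜 1) (m : ℕ) (y : A ⊗[k] ExteriorAlgebra k L) :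
    koszulDiff x b (coeffProj L 𝒜 m y) = coeffProj L 𝒜 (m + 1) (koszulDiff x b y) := by
  induction y using TensorProduct.induction_on with
  | zero => simp
  | add y z hy hz => simp only [map_add, hy, hz]
  | tmul a ω =>
    simp only [coeffProj_tmul, koszulDiff_tmul, map_sum, GradedAlgebra.proj_apply]
    refine Finset.sum_congr rfl fun i _ => ?_
    rw [DirectSum.coe_decompose_mul_add_of_right_mem 𝒜 (hx _)]

theorem coeffProj_zero_koszulDiff (hx : ∀ l, x l ∈ 𝒜 1) (y : A ⊗[k] ExteriorAlgebra k L) :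
    coeffProj L 𝒜 0 (koszulDiff x b y) = 0 := by
  induction y using TensorProduct.induction_on with
  | zero => simp
  | add y z hy hz => simp only [map_add, hy, hz, add_zero]
  | tmul a ω =>
    simp only [coeffProj_tmul, koszulDiff_tmul, map_sum, GradedAlgebra.proj_apply]
    refine Finset.sum_eq_zero fun i _ => ?_
    rw [DirectSum.coe_decompose_mul_of_right_mem_of_not_le 𝒜 (hx _) (by simp),
      TensorProduct.zero_tmul]

theorem contractLeft_proj (φ : Module.Dual k L) (n : ℕ) (ω : ExteriorAlgebra k L) :
    contractLeft (Q := (0 : QuadraticForm k L)) φ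
        (GradedAlgebra.proj (fun n : ℕ => ⋀[k]^n L) (n + 1) ω) =
      GradedAlgebra.proj (fun n : ℕ => ⋀[k]^n L) n
        (contractLeft (Q := (0 : QuadraticForm k L)) φ ω) := by
  obtain ⟨N, hN⟩ := GradedAlgebra.exists_sum_proj (fun n : ℕ => ⋀[k]^n L) ω
  have key : ∀ m, GradedAlgebra.proj (fun n : ℕ => ⋀[k]^n L) n
      (contractLeft (Q := (0 : QuadraticForm k L)) φ
        (GradedAlgebra.proj (fun n : ℕ => ⋀[k]^n L) m ω)) =
      if m = n + 1 then contractLeft (Q := (0 : QuadraticForm k L)) φ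
        (GradedAlgebra.proj (fun n : ℕ => ⋀[k]^n L) m ω) else 0 := by
    intro m
    obtain ⟨h1, h2⟩ := contractLeft_mem_exteriorPower φ (n := m)
      (ω := GradedAlgebra.proj (fun n : ℕ => ⋀[k]^n L) m ω) (SetLike.coe_mem _)
    rw [GradedAlgebra.proj_apply]
    split_ifs with h
    · subst h
      exact DirectSum.decompose_of_mem_same _ h1
    · rcases m with _ | m
      · rw [h2 rfl]; simp
      · exact DirectSum.decompose_of_mem_ne _ h1 (by omega)
  conv_rhs => rw [← hN (max N (n + 2)) (le_max_left _ _), map_sum, map_sum]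
  simp only [key]
  rw [Finset.sum_ite_eq', if_pos (Finset.mem_range.2 (by omega))]

theorem koszulDiff_formProj (n : ℕ) (y : A ⊗[k] ExteriorAlgebra k L) :
    koszulDiff x b (formProj k A L (n + 1) y) = formProj k A L n (koszulDiff x b y) := by
  induction y using TensorProduct.induction_on with
  | zero => simp
  | add y z hy hz => simp only [map_add, hy, hz]
  | tmul a ω => simp only [formProj_tmul, koszulDiff_tmul, map_sum, contractLeft_proj]

/-- `IsPartialDerivatives.homotopy` for the bihomogeneous components of an arbitrary form. -/
theorem IsPartialDerivatives.homotopy_proj (h : IsPartialDerivatives 𝒜 x b D) (m n : ℕ)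
    (y : A ⊗[k] ExteriorAlgebra k L) :
    koszulDiff x b (deRhamDiff D b (coeffProj L 𝒜 m (formProj k A L n y))) +
      deRhamDiff D b (koszulDiff x b (coeffProj L 𝒜 m (formProj k A L n y))) =
      ((m + n : ℕ) : k) • coeffProj L 𝒜 m (formProj k A L n y) := by
  induction y using TensorProduct.induction_on with
  | zero => simp
  | add y z hy hz =>
    simp only [map_add, smul_add, ← hy, ← hz]
    abel
  | tmul a ω => exact h.homotopy (SetLike.coe_mem _) (SetLike.coe_mem _)

/-- The Koszul complex is exact in positive total degree: divide the value of the de Rham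
differential on each bihomogeneous component by its total degree. -/
theorem IsPartialDerivatives.exists_koszulDiff_eq [CharZero k] (h : IsPartialDerivatives 𝒜 x b D)
    {n : ℕ} {y : A ⊗[k] ExteriorAlgebra k L} (hy : formProj k A L n y = y)
    (hd : koszulDiff x b y = 0) (h0 : n = 0 → coeffProj L 𝒜 0 y = 0) :
    ∃ z, formProj k A L (n + 1) z = z ∧ koszulDiff x b z = y := by
  obtain ⟨N, hN⟩ := exists_sum_coeffProj 𝒜 y
  refine ⟨formProj k A L (n + 1) (∑ m ∈ Finset.range N,
    ((m + n : ℕ) : k)⁻¹ • deRhamDiff D b (coeffProj L 𝒜 m y)), formProj_formProj _ _, ?_⟩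
  rw [koszulDiff_formProj]
  conv_rhs => rw [← hy, ← hN N le_rfl]
  congr 1
  rw [map_sum]
  refine Finset.sum_congr rfl fun m _ => ?_
  have h1 := h.homotopy_proj m n y
  rw [hy, koszulDiff_coeffProj h.mem_one, hd, map_zero, map_zero, add_zero] at h1
  rw [LinearMap.map_smul_of_tower, h1, smul_smul]
  -- In total degree zero the inverse is a junk value, but there the component of `y` vanishes.
  by_cases hmn : m + n = 0
  · obtain ⟨rfl, rfl⟩ : m = 0 ∧ n = 0 := by omega
    rw [h0 rfl, smul_zero]
  · rw [inv_mul_cancel₀ (Nat.cast_ne_zero.2 hmn), one_smul]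

end KoszulGrading

/-! ### The diagonal group action -/

theorem GradedAlgebra.proj_map_of_mem {k R S : Type*} [Field k] [Ring R] [Algebra k R] [Ring S]
    [Algebra k S] (ℛ : ℕ → Submodule k R) [GradedAlgebra ℛ] (𝒮 : ℕ → Submodule k S)
    [GradedAlgebra 𝒮] (f : R →ₗ[k] S) (hf : ∀ n, ∀ r ∈ ℛ n, f r ∈ 𝒮 n) (n : ℕ) (r : R) :
    f (GradedAlgebra.proj ℛ n r) = GradedAlgebra.proj 𝒮 n (f r) := by
  induction r using DirectSum.Decomposition.inductionOn ℛ with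
  | zero => simp
  | add r r' h h' => simp only [map_add, h, h']
  | @homogeneous i r =>
    simp only [GradedAlgebra.proj_apply]
    by_cases hi : i = n
    · subst hi
      rw [DirectSum.decompose_of_mem_same _ r.2, DirectSum.decompose_of_mem_same _ (hf _ _ r.2)]
    · rw [DirectSum.decompose_of_mem_ne _ r.2 hi, DirectSum.decompose_of_mem_ne _ (hf _ _ r.2) hi,
        map_zero]

section DiagonalAction

variable {k : Type*} [Field k] {A : Type*} [Ring A] [Algebra k A]
  {L : Type*} [AddCommGroup L] [Module k L] {I : Type*} [Fintype I] {G : Type*} [Group G]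

open CliffordAlgebra (contractLeft)

theorem exteriorMap_mem {M N : Type*} [AddCommGroup M] [Module k M] [AddCommGroup N] [Module k N]
    (f : M →ₗ[k] N) {n : ℕ} {ω : ExteriorAlgebra k M} (hω : ω ∈ ⋀[k]^n M) :
    ExteriorAlgebra.map f ω ∈ ⋀[k]^n N := by
  have h : (⋀[k]^n M).map (ExteriorAlgebra.map f).toLinearMap ≤ ⋀[k]^n N := by
    rw [Submodule.map_pow]
    refine pow_le_pow_left' ?_ n
    rintro _ ⟨_, ⟨m, rfl⟩, rfl⟩
    exact ⟨f m, by simp⟩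
  exact h ⟨ω, hω, rfl⟩

/-- Contraction is natural with respect to the maps of exterior algebras induced by linear maps. -/
theorem exteriorMap_contractLeft {M N : Type*} [AddCommGroup M] [Module k M] [AddCommGroup N]
    [Module k N] (f : M →ₗ[k] N) (φ : Module.Dual k N) (ω : ExteriorAlgebra k M) :
    ExteriorAlgebra.map f (contractLeft (Q := (0 : QuadraticForm k M)) (φ ∘ₗ f) ω) =
      contractLeft (Q := (0 : QuadraticForm k N)) φ (ExteriorAlgebra.map f ω) := by
  induction ω using CliffordAlgebra.left_induction with
  | algebraMap r =>
    have h1 : contractLeft (Q := (0 : QuadraticForm k M)) (φ ∘ₗ f) (algebraMap k _ r) = 0 :=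
      CliffordAlgebra.contractLeft_algebraMap _ _ r
    have h2 : contractLeft (Q := (0 : QuadraticForm k N)) φ (algebraMap k _ r) = 0 :=
      CliffordAlgebra.contractLeft_algebraMap _ φ r
    have h3 : ExteriorAlgebra.map f (algebraMap k (CliffordAlgebra (0 : QuadraticForm k M)) r) =
      algebraMap k (CliffordAlgebra (0 : QuadraticForm k N)) r := AlgHom.commutes _ r
    rw [h1, h3, h2, map_zero]
  | add x y hx hy => simp only [map_add, hx, hy]
  | ι_mul x m hx =>
    have h1 : contractLeft (Q := (0 : QuadraticForm k M)) (φ ∘ₗ f) (ExteriorAlgebra.ι k m * x) =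
        φ (f m) • x - ExteriorAlgebra.ι k m *
          contractLeft (Q := (0 : QuadraticForm k M)) (φ ∘ₗ f) x :=
      CliffordAlgebra.contractLeft_ι_mul _ m x
    have h2 : contractLeft (Q := (0 : QuadraticForm k N)) φ
        (ExteriorAlgebra.ι k (f m) * ExteriorAlgebra.map f x) =
        φ (f m) • ExteriorAlgebra.map f x - ExteriorAlgebra.ι k (f m) *
          contractLeft (Q := (0 : QuadraticForm k N)) φ (ExteriorAlgebra.map f x) :=
      CliffordAlgebra.contractLeft_ι_mul _ _ _
    change ExteriorAlgebra.map f (contractLeft (Q := (0 : QuadraticForm k M)) (φ ∘ₗ f)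
      (ExteriorAlgebra.ι k m * x)) = contractLeft (Q := (0 : QuadraticForm k N)) φ
        (ExteriorAlgebra.map f (ExteriorAlgebra.ι k m * x))
    rw [h1, map_sub, map_smul, map_mul, map_mul, hx, ExteriorAlgebra.map_apply_ι, h2]

/-- The value of a bilinear map on the canonical element `∑ i, bᵢ ⊗ bᵢ^*` does not depend on the
basis. -/
theorem sum_basis_coord_eq {M : Type*} [AddCommGroup M] [Module k M]
    (F : L →ₗ[k] Module.Dual k L →ₗ[k] M) (b c : Module.Basis I k L) :
    ∑ i, F (b i) (b.coord i) = ∑ i, F (c i) (c.coord i) := by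
  have h1 : ∀ i, F (c i) (c.coord i) = ∑ j, F (b j) (b.coord j (c i) • c.coord i) := by
    intro i
    conv_lhs => rw [← b.sum_repr (c i), map_sum, LinearMap.sum_apply]
    simp
  have h2 : ∀ j, ∑ i, b.coord j (c i) • c.coord i = b.coord j := by
    intro j
    refine c.ext fun m => ?_
    simp only [LinearMap.sum_apply, LinearMap.smul_apply, Module.Basis.coord_apply,
      Module.Basis.repr_self]
    classical
    simp [Finsupp.single_apply]
  simp only [h1]
  rw [Finset.sum_comm]
  refine Finset.sum_congr rfl fun j _ => ?_
  rw [← map_sum, h2]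

/-- The diagonal action on `A ⊗ ⋀ L` of a group acting on `A` and on `L`. -/
noncomputable def diagAct (act : G →* (A →ₐ[k] A)) (θ : Representation k G L) (g : G) :
    A ⊗[k] ExteriorAlgebra k L →ₗ[k] A ⊗[k] ExteriorAlgebra k L :=
  TensorProduct.map (act g).toLinearMap (ExteriorAlgebra.map (θ g)).toLinearMap

variable {act : G →* (A →ₐ[k] A)} {θ : Representation k G L}

@[simp]
theorem diagAct_tmul (g : G) (a : A) (ω : ExteriorAlgebra k L) :
    diagAct act θ g (a ⊗ₜ ω) = act g a ⊗ₜ[k] ExteriorAlgebra.map (θ g) ω := rfl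

theorem diagAct_mul (g h : G) (y : A ⊗[k] ExteriorAlgebra k L) :
    diagAct act θ (g * h) y = diagAct act θ g (diagAct act θ h y) := by
  induction y using TensorProduct.induction_on with
  | zero => simp
  | add y z hy hz => simp only [map_add, hy, hz]
  | tmul a ω =>
    simp only [diagAct_tmul, map_mul, AlgHom.mul_apply]
    congr 1
    rw [Module.End.mul_eq_comp, ← ExteriorAlgebra.map_comp_map, AlgHom.comp_apply]

theorem diagAct_smul (g : G) (a : A) (y : A ⊗[k] ExteriorAlgebra k L) :
    diagAct act θ g (a • y) = act g a • diagAct act θ g y := by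
  induction y using TensorProduct.induction_on with
  | zero => simp
  | add y z hy hz => simp only [smul_add, map_add, hy, hz]
  | tmul a ω => simp [TensorProduct.smul_tmul']

theorem diagAct_formProj (g : G) (n : ℕ) (y : A ⊗[k] ExteriorAlgebra k L) :
    diagAct act θ g (formProj k A L n y) = formProj k A L n (diagAct act θ g y) := by
  induction y using TensorProduct.induction_on with
  | zero => simp
  | add y z hy hz => simp only [map_add, hy, hz]
  | tmul a ω =>
    simp only [diagAct_tmul, formProj_tmul]
    congr 1
    exact (GradedAlgebra.proj_map_of_mem _ _ (ExteriorAlgebra.map (θ g)).toLinearMap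
      (fun _ _ h => exteriorMap_mem _ h) n ω)

theorem diagAct_coeffProj {𝒜 : ℕ → Submodule k A} [GradedAlgebra 𝒜]
    (hact : ∀ g m, ∀ a ∈ 𝒜 m, act g a ∈ 𝒜 m) (g : G) (m : ℕ)
    (y : A ⊗[k] ExteriorAlgebra k L) :
    diagAct act θ g (coeffProj L 𝒜 m y) = coeffProj L 𝒜 m (diagAct act θ g y) := by
  induction y using TensorProduct.induction_on with
  | zero => simp
  | add y z hy hz => simp only [map_add, hy, hz]
  | tmul a ω =>
    simp only [diagAct_tmul, coeffProj_tmul]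
    congr 1
    exact (GradedAlgebra.proj_map_of_mem _ _ (act g).toLinearMap (fun m a h => hact g m a h) m a)

/-- The Koszul differential of an equivariant linear map is equivariant. -/
theorem diagAct_koszulDiff {x : L →ₗ[k] A} (hx : ∀ g l, act g (x l) = x (θ g l))
    (b : Module.Basis I k L) (g : G) (y : A ⊗[k] ExteriorAlgebra k L) :
    diagAct act θ g (koszulDiff x b y) = koszulDiff x b (diagAct act θ g y) := by
  induction y using TensorProduct.induction_on with
  | zero => simp
  | add y z hy hz => simp only [map_add, hy, hz]
  | tmul a ω =>
    -- Moving `g` past the differential replaces the basis `b` by its translate `g b`.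
    let e : L ≃ₗ[k] L := LinearEquiv.ofLinearMap (θ g) (θ g⁻¹) (by ext; simp) (by ext; simp)
    let F : L →ₗ[k] Module.Dual k L →ₗ[k] A ⊗[k] ExteriorAlgebra k L :=
      LinearMap.mk₂ k (fun l φ => (act g a * x l) ⊗ₜ[k]
        contractLeft (Q := (0 : QuadraticForm k L)) φ (ExteriorAlgebra.map (θ g) ω))
        (fun l l' φ => by rw [map_add, mul_add, TensorProduct.add_tmul])
        (fun c l φ => by rw [map_smul, mul_smul_comm, TensorProduct.smul_tmul'])
        (fun l φ φ' => by rw [map_add, LinearMap.add_apply, TensorProduct.tmul_add])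
        (fun c l φ => by rw [map_smul, LinearMap.smul_apply, TensorProduct.tmul_smul])
    rw [diagAct_tmul, koszulDiff_tmul, koszulDiff_tmul, map_sum]
    refine Eq.trans ?_ (sum_basis_coord_eq F (b.map e) b)
    refine Finset.sum_congr rfl fun i _ => ?_
    have h1 : (b.map e).coord i ∘ₗ θ g = b.coord i := by
      ext l
      have : e.symm (θ g l) = l := e.symm_apply_apply l
      simp [this]
    rw [diagAct_tmul, map_mul, hx, ← h1, exteriorMap_contractLeft]
    rfl

end DiagonalAction

/-! ### Invariant primitives and invariant dual bases -/

section EquivariantKoszul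

variable {k : Type*} [Field k] {A : Type*} [Ring A] [Algebra k A]
  {L : Type*} [AddCommGroup L] [Module k L] {I : Type*} [Fintype I] {G : Type*} [Group G]

/-- A system of partial derivatives on a graded algebra `A` together with actions of `G` on `A` and
`L` for which `x : L → A` is equivariant. The operators `D i` need not be equivariant. -/
structure IsEquivariantSystem (𝒜 : ℕ → Submodule k A) (act : G →* (A →ₐ[k] A))
    (θ : Representation k G L) (x : L →ₗ[k] A) (b : Module.Basis I k L) (D : I → A →ₗ[k] A) : Prop
    extends IsPartialDerivatives 𝒜 x b D where
  act_mem : ∀ g m, ∀ a ∈ 𝒜 m, act g a ∈ 𝒜 m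
  act_apply : ∀ g l, act g (x l) = x (θ g l)

variable {𝒜 : ℕ → Submodule k A} [GradedAlgebra 𝒜] {act : G →* (A →ₐ[k] A)}
  {θ : Representation k G L} {x : L →ₗ[k] A} {b : Module.Basis I k L} {D : I → A →ₗ[k] A}

/-- Averaging over the finite group `G` makes primitives of invariant Koszul cycles invariant. -/
theorem IsEquivariantSystem.exists_invariant_koszulDiff_eq [Finite G] [CharZero k]
    (h : IsEquivariantSystem 𝒜 act θ x b D) {n : ℕ} {y : A ⊗[k] ExteriorAlgebra k L}
    (hG : ∀ g, diagAct act θ g y = y) (hy : formProj k A L n y = y)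
    (hd : koszulDiff x b y = 0) (h0 : n = 0 → coeffProj L 𝒜 0 y = 0) :
    ∃ z, (∀ g, diagAct act θ g z = z) ∧ formProj k A L (n + 1) z = z ∧ koszulDiff x b z = y := by
  have := Fintype.ofFinite G
  obtain ⟨z, hz, hzd⟩ := h.exists_koszulDiff_eq hy hd h0
  refine ⟨(Fintype.card G : k)⁻¹ • ∑ g, diagAct act θ g z, fun g => ?_, ?_, ?_⟩
  · rw [map_smul, map_sum]
    congr 1
    simp only [← diagAct_mul]
    exact Fintype.sum_equiv (Equiv.mulLeft g) _ _ fun _ => rfl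
  · rw [LinearMap.map_smul_of_tower, map_sum]
    simp only [← diagAct_formProj, hz]
  · rw [LinearMap.map_smul_of_tower, map_sum]
    simp only [← diagAct_koszulDiff h.act_apply, hzd, hG]
    rw [Finset.sum_const, Finset.card_univ, ← Nat.cast_smul_eq_nsmul k, smul_smul,
      inv_mul_cancel₀ (Nat.cast_ne_zero.2 Fintype.card_ne_zero), one_smul]

theorem coeffProj_zero_smul (a : A) (y : A ⊗[k] ExteriorAlgebra k L) :
    coeffProj L 𝒜 0 (a • y) = GradedAlgebra.proj 𝒜 0 a • coeffProj L 𝒜 0 y := by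
  induction y using TensorProduct.induction_on with
  | zero => simp
  | add y z hy hz => simp only [smul_add, map_add, hy, hz]
  | tmul a' ω =>
    simp only [TensorProduct.smul_tmul', coeffProj_tmul, smul_eq_mul]
    congr 1
    exact map_mul (GradedRing.projZeroRingHom 𝒜) a a'

theorem GradedAlgebra.proj_one_mul {R : Type*} [Ring R] [Algebra k R] (ℛ : ℕ → Submodule k R)
    [GradedAlgebra ℛ] (r s : R) : GradedAlgebra.proj ℛ 1 (r * s) =
      GradedAlgebra.proj ℛ 0 r * GradedAlgebra.proj ℛ 1 s +
        GradedAlgebra.proj ℛ 1 r * GradedAlgebra.proj ℛ 0 s := by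
  induction r using DirectSum.Decomposition.inductionOn ℛ with
  | zero => simp
  | add r r' h h' => simp only [map_add, add_mul, h, h']; abel
  | @homogeneous i r =>
    simp only [GradedAlgebra.proj_apply]
    rcases i with _ | _ | i
    · rw [DirectSum.coe_decompose_mul_of_left_mem_zero ℛ r.2,
        DirectSum.decompose_of_mem_same _ r.2,
        DirectSum.decompose_of_mem_ne _ r.2 (by simp), zero_mul, add_zero]
    · rw [DirectSum.coe_decompose_mul_of_left_mem_of_le ℛ r.2 (by simp),
        DirectSum.decompose_of_mem_same _ r.2,
        DirectSum.decompose_of_mem_ne _ r.2 (by simp), zero_mul]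
      simp
    · rw [DirectSum.coe_decompose_mul_of_left_mem_of_not_le ℛ r.2 (by omega),
        DirectSum.decompose_of_mem_ne _ r.2 (by omega),
        DirectSum.decompose_of_mem_ne _ r.2 (by omega), zero_mul, zero_mul, add_zero]

theorem coeffProj_one_smul (a : A) (y : A ⊗[k] ExteriorAlgebra k L) :
    coeffProj L 𝒜 1 (a • y) = GradedAlgebra.proj 𝒜 0 a • coeffProj L 𝒜 1 y +
      GradedAlgebra.proj 𝒜 1 a • coeffProj L 𝒜 0 y := by
  induction y using TensorProduct.induction_on with
  | zero => simp
  | add y z hy hz => simp only [smul_add, map_add, hy, hz]; abel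
  | tmul a' ω =>
    simp only [TensorProduct.smul_tmul', coeffProj_tmul, smul_eq_mul, ← TensorProduct.add_tmul,
      GradedAlgebra.proj_one_mul]

/-- The projection of the exterior algebra onto degree zero is its augmentation. -/
theorem exteriorAlgebra_proj_zero (ω : ExteriorAlgebra k L) :
    GradedAlgebra.proj (fun n : ℕ => ⋀[k]^n L) 0 ω =
      algebraMap k _ (ExteriorAlgebra.algebraMapInv ω) := by
  have hpos : ∀ n, ∀ ω ∈ ⋀[k]^n L, n ≠ 0 → ExteriorAlgebra.algebraMapInv ω = 0 := by
    intro n ω hω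
    induction hω using Submodule.pow_induction_on_left' with
    | algebraMap r => exact fun h => absurd rfl h
    | add x y i hx hy ihx ihy => exact fun h => by rw [map_add, ihx h, ihy h, add_zero]
    | mem_mul m hm i x hx ih =>
      obtain ⟨l, rfl⟩ := hm
      intro _
      simp [ExteriorAlgebra.algebraMapInv]
  induction ω using DirectSum.Decomposition.inductionOn (fun n : ℕ => ⋀[k]^n L) with
  | zero => simp
  | add r r' h h' => simp only [map_add, h, h']
  | @homogeneous i r =>
    rw [GradedAlgebra.proj_apply]
    by_cases hi : i = 0
    · subst hi
      rw [DirectSum.decompose_of_mem_same (fun n : ℕ => ⋀[k]^n L) r.2]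
      obtain ⟨r, hr⟩ := r
      have hr' : r ∈ LinearMap.range (ExteriorAlgebra.ι k (M := L)) ^ 0 := hr
      rw [pow_zero, Submodule.mem_one] at hr'
      obtain ⟨c, rfl⟩ := hr'
      rw [ExteriorAlgebra.algebraMap_leftInverse L c]
    · rw [DirectSum.decompose_of_mem_ne (fun n : ℕ => ⋀[k]^n L) r.2 hi, hpos i r r.2 hi, map_zero]

variable (k A L) in
/-- The map `A ⊗ ⋀ L → A` given by the augmentation of the exterior algebra. -/
noncomputable def formCounit : A ⊗[k] ExteriorAlgebra k L →ₗ[A] A :=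
  (TensorProduct.AlgebraTensorModule.rid k A A).toLinearMap ∘ₗ
    (ExteriorAlgebra.algebraMapInv (R := k) (M := L)).toLinearMap.baseChange A

theorem formCounit_tmul (a : A) (ω : ExteriorAlgebra k L) :
    formCounit k A L (a ⊗ₜ ω) = ExteriorAlgebra.algebraMapInv ω • a := by
  simp [formCounit]

theorem formProj_zero (y : A ⊗[k] ExteriorAlgebra k L) :
    formProj k A L 0 y = formCounit k A L y ⊗ₜ[k] 1 := by
  induction y using TensorProduct.induction_on with
  | zero => simp
  | add y z hy hz => simp only [map_add, hy, hz, TensorProduct.add_tmul]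
  | tmul a ω =>
    rw [formProj_tmul, formCounit_tmul, exteriorAlgebra_proj_zero, Algebra.algebraMap_eq_smul_one,
      TensorProduct.tmul_smul, TensorProduct.smul_tmul']

theorem formCounit_tmul_one (a : A) : formCounit k A L (a ⊗ₜ 1) = a := by
  simp [formCounit_tmul]

theorem formCounit_diagAct (g : G) (y : A ⊗[k] ExteriorAlgebra k L) :
    formCounit k A L (diagAct act θ g y) = act g (formCounit k A L y) := by
  induction y using TensorProduct.induction_on with
  | zero => simp
  | add y z hy hz => simp only [map_add, hy, hz]
  | tmul a ω =>
    have h : (ExteriorAlgebra.algebraMapInv (R := k) (M := L)).comp (ExteriorAlgebra.map (θ g)) =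
        ExteriorAlgebra.algebraMapInv := by
      ext l; simp [ExteriorAlgebra.algebraMapInv]
    rw [diagAct_tmul, formCounit_tmul, formCounit_tmul, map_smul]
    exact congrArg (· • act g a) (DFunLike.congr_fun h ω)

theorem formCounit_coeffProj (m : ℕ) (y : A ⊗[k] ExteriorAlgebra k L) :
    formCounit k A L (coeffProj L 𝒜 m y) = GradedAlgebra.proj 𝒜 m (formCounit k A L y) := by
  induction y using TensorProduct.induction_on with
  | zero => simp
  | add y z hy hz => simp only [map_add, hy, hz]
  | tmul a ω => rw [coeffProj_tmul, formCounit_tmul, formCounit_tmul, map_smul]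

variable (𝒜 act θ) in
/-- A finite family of invariant vectors of `𝒜 0 ⊗ ⋀ L` and of equivariant functionals
`⋀ L → 𝒜 0` whose `A`-linear extensions form a dual basis of the `A`-module `A ⊗ ⋀ L`. -/
structure InvariantDualBasis (κ : Type*) [Fintype κ] where
  /-- the functionals -/
  coord : κ → ExteriorAlgebra k L →ₗ[k] A
  /-- the vectors -/
  vec : κ → A ⊗[k] ExteriorAlgebra k L
  coord_mem : ∀ j ω, coord j ω ∈ 𝒜 0
  act_coord : ∀ g j ω, act g (coord j ω) = coord j (ExteriorAlgebra.map (θ g) ω)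
  diagAct_vec : ∀ g j, diagAct act θ g (vec j) = vec j
  coeffProj_vec : ∀ j, coeffProj L 𝒜 0 (vec j) = vec j
  sum_coord_smul_vec : ∀ ω, ∑ j, coord j ω • vec j = 1 ⊗ₜ[k] ω

namespace InvariantDualBasis

variable {κ : Type*} [Fintype κ] (δ : InvariantDualBasis 𝒜 act θ κ)

/-- The `A`-linear extension of a functional of the dual basis. -/
noncomputable def functional (j : κ) : A ⊗[k] ExteriorAlgebra k L →ₗ[A] A :=
  TensorProduct.AlgebraTensorModule.lift
    { toFun := fun a => LinearMap.mulLeft k a ∘ₗ δ.coord j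
      map_add' := fun a a' => by ext; simp [add_mul]
      map_smul' := fun a a' => by ext; simp }

theorem functional_tmul (j : κ) (a : A) (ω : ExteriorAlgebra k L) :
    δ.functional j (a ⊗ₜ ω) = a * δ.coord j ω := rfl

theorem sum_functional_smul_vec (y : A ⊗[k] ExteriorAlgebra k L) :
    ∑ j, δ.functional j y • δ.vec j = y := by
  induction y using TensorProduct.induction_on with
  | zero => simp
  | add y z hy hz => simp only [map_add, add_smul, Finset.sum_add_distrib, hy, hz]
  | tmul a ω =>
    simp only [functional_tmul, mul_smul, ← Finset.smul_sum, δ.sum_coord_smul_vec]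
    simp [TensorProduct.smul_tmul']

theorem act_functional (g : G) (j : κ) (y : A ⊗[k] ExteriorAlgebra k L) :
    act g (δ.functional j y) = δ.functional j (diagAct act θ g y) := by
  induction y using TensorProduct.induction_on with
  | zero => simp
  | add y z hy hz => simp only [map_add, hy, hz]
  | tmul a ω => simp only [functional_tmul, diagAct_tmul, map_mul, δ.act_coord]

theorem proj_functional (m : ℕ) (j : κ) (y : A ⊗[k] ExteriorAlgebra k L) :
    GradedAlgebra.proj 𝒜 m (δ.functional j y) = δ.functional j (coeffProj L 𝒜 m y) := by
  induction y using TensorProduct.induction_on with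
  | zero => simp
  | add y z hy hz => simp only [map_add, hy, hz]
  | tmul a ω =>
    simp only [functional_tmul, coeffProj_tmul, GradedAlgebra.proj_apply]
    rw [DirectSum.coe_decompose_mul_of_right_mem_zero 𝒜 (δ.coord_mem j ω)]

end InvariantDualBasis

end EquivariantKoszul

/-! ### Invariant Koszul forms as modules over the invariants -/

section InvariantKoszul

/-- A map that vanishes on the kernel of a map `g` to a semisimple module extends along `g`. -/
theorem exists_extension_of_ker_le {R N Y X : Type*} [Ring R] [AddCommGroup N] [Module R N]
    [AddCommGroup Y] [Module R Y] [AddCommGroup X] [Module R X] [IsSemisimpleModule R Y]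
    (g : N →ₗ[R] Y) (f : N →ₗ[R] X) (h : LinearMap.ker g ≤ LinearMap.ker f) :
    ∃ f' : Y →ₗ[R] X, ∀ y, f' (g y) = f y := by
  obtain ⟨f', hf'⟩ := IsSemisimpleModule.extension_property
    ((LinearMap.ker g).liftQ g le_rfl) (LinearMap.ker_eq_bot.1 (by
      rw [Submodule.ker_liftQ_eq_bot _ _ _ le_rfl])) ((LinearMap.ker g).liftQ f h)
  exact ⟨f', fun y => DFunLike.congr_fun hf' ((LinearMap.ker g).mkQ y)⟩

section Irrelevant

variable {k : Type*} [CommRing k] {B : Type*} [Ring B] [Algebra k B] (ℬ : ℕ → Submodule k B)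
  [GradedAlgebra ℬ]

theorem mem_irrelevant_iff_proj (b : B) : b ∈ (HomogeneousIdeal.irrelevant ℬ).toIdeal ↔
    GradedAlgebra.proj ℬ 0 b = 0 := by
  rw [GradedAlgebra.proj_apply]
  exact HomogeneousIdeal.mem_irrelevant_iff ℬ b

theorem irrelevant_isTwoSided : (HomogeneousIdeal.irrelevant ℬ).toIdeal.IsTwoSided := by
  refine ⟨fun {a} b ha => ?_⟩
  rw [mem_irrelevant_iff_proj] at ha ⊢
  refine (map_mul (GradedRing.projZeroRingHom ℬ) a b).trans ?_
  change GradedAlgebra.proj ℬ 0 a * _ = 0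
  rw [ha, zero_mul]

/-- A module killed by `B_{≥ 1}` is semisimple when the ring `B₀` is. -/
theorem isSemisimpleModule_of_irrelevant_smul [IsSemisimpleRing (ℬ 0)] {Y : Type*} [AddCommGroup Y]
    [Module B Y] (hY : ∀ b ∈ (HomogeneousIdeal.irrelevant ℬ).toIdeal, ∀ y : Y, b • y = 0) :
    IsSemisimpleModule B Y := by
  have := irrelevant_isTwoSided ℬ
  set J := (HomogeneousIdeal.irrelevant ℬ).toIdeal
  let π : ℬ 0 →+* B ⧸ J :=
    { toFun := fun b => Ideal.Quotient.mk J b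
      map_one' := map_one (Ideal.Quotient.mk J)
      map_mul' := fun a b => map_mul (Ideal.Quotient.mk J) _ _
      map_zero' := map_zero (Ideal.Quotient.mk J)
      map_add' := fun a b => map_add (Ideal.Quotient.mk J) _ _ }
  have hπ : Function.Surjective π := by
    intro c
    obtain ⟨b, rfl⟩ := Ideal.Quotient.mk_surjective c
    refine ⟨DirectSum.decompose ℬ b 0, ?_⟩
    change Ideal.Quotient.mk J _ = _
    rw [Ideal.Quotient.eq, mem_irrelevant_iff_proj, map_sub, sub_eq_zero]
    rw [GradedAlgebra.proj_apply, GradedAlgebra.proj_apply,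
      DirectSum.decompose_of_mem_same ℬ (SetLike.coe_mem _)]
  have : IsSemisimpleRing (B ⧸ J) := π.isSemisimpleRing_of_surjective hπ
  have hM : Module.IsTorsionBySet B Y J := fun y b => hY b b.2 y
  let := hM.module
  exact hM.isSemisimpleModule_iff.1 inferInstance

/-- If `B_{≥ 1}` maps the submodule `F` into `K` and `B₀` is semisimple, a map from a submodule
`N` of `F` which kills `N ∩ K` extends to `F`. -/
theorem exists_extension_of_irrelevant_smul_mem [IsSemisimpleRing (ℬ 0)] {P N X : Type*}
    [AddCommGroup P] [Module B P] [AddCommGroup N] [Module B N] [AddCommGroup X] [Module B X]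
    (i : N →ₗ[B] P) (F K : Submodule B P) (hi : ∀ y, i y ∈ F)
    (hK : ∀ b ∈ (HomogeneousIdeal.irrelevant ℬ).toIdeal, ∀ y ∈ F, b • y ∈ K) (f : N →ₗ[B] X)
    (hf : ∀ y, i y ∈ K → f y = 0) : ∃ f' : F →ₗ[B] X, ∀ y, f' ⟨i y, hi y⟩ = f y := by
  have hss : IsSemisimpleModule B (F ⧸ K.comap F.subtype) := by
    refine isSemisimpleModule_of_irrelevant_smul ℬ fun c hc y => ?_
    obtain ⟨y, rfl⟩ := Submodule.mkQ_surjective _ y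
    rw [← map_smul, Submodule.mkQ_apply, Submodule.Quotient.mk_eq_zero]
    exact hK c hc y y.2
  obtain ⟨f', hf'⟩ := exists_extension_of_ker_le
    ((K.comap F.subtype).mkQ ∘ₗ i.codRestrict F hi) f (by
      intro y hy
      rw [LinearMap.mem_ker, LinearMap.comp_apply, Submodule.mkQ_apply,
        Submodule.Quotient.mk_eq_zero] at hy
      exact hf y hy)
  exact ⟨f' ∘ₗ (K.comap F.subtype).mkQ, hf'⟩

end Irrelevant

variable {k : Type*} [Field k] {A : Type*} [Ring A] [Algebra k A]
  {L : Type*} [AddCommGroup L] [Module k L] {I : Type*} [Fintype I] {G : Type*} [Group G]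
  {𝒜 : ℕ → Submodule k A} {act : G →* (A →ₐ[k] A)}
  {θ : Representation k G L} {x : L →ₗ[k] A} {b : Module.Basis I k L} {D : I → A →ₗ[k] A}
  {B : Subalgebra k A}

/-- The invariants of `A ⊗ ⋀^n L`, as a module over the algebra of invariants of `A`. -/
noncomputable def invariantForms (hB : ∀ a, a ∈ B ↔ ∀ g, act g a = a) (θ : Representation k G L)
    (n : ℕ) : Submodule B (A ⊗[k] ExteriorAlgebra k L) where
  carrier := {y | (∀ g, diagAct act θ g y = y) ∧ formProj k A L n y = y}
  add_mem' {y z} hy hz := ⟨fun g => by rw [map_add, hy.1, hz.1], by rw [map_add, hy.2, hz.2]⟩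
  zero_mem' := ⟨fun g => map_zero _, map_zero _⟩
  smul_mem' c y hy := ⟨fun g => by
    rw [Subalgebra.smul_def, diagAct_smul, (hB c).1 c.2, hy.1], by
    rw [Subalgebra.smul_def, map_smul, hy.2]⟩

theorem koszulDiff_mem_invariantForms {hB : ∀ a, a ∈ B ↔ ∀ g, act g a = a}
    (h : IsEquivariantSystem 𝒜 act θ x b D) {n : ℕ}
    {y : A ⊗[k] ExteriorAlgebra k L} (hy : y ∈ invariantForms hB θ (n + 1)) :
    koszulDiff x b y ∈ invariantForms hB θ n :=
  ⟨fun g => by rw [diagAct_koszulDiff h.act_apply, hy.1], by rw [← koszulDiff_formProj, hy.2]⟩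

/-- The Koszul cycles in the invariants of `A ⊗ ⋀^n L` with vanishing component in degree zero of
the coefficient algebra. Only for `n = 0` is the latter a condition. -/
noncomputable def invariantCycles (𝒜 : ℕ → Submodule k A) [GradedAlgebra 𝒜]
    (hB : ∀ a, a ∈ B ↔ ∀ g, act g a = a) (θ : Representation k G L) (x : L →ₗ[k] A)
    (b : Module.Basis I k L) (n : ℕ) : Submodule B (A ⊗[k] ExteriorAlgebra k L) where
  carrier := {y | y ∈ invariantForms hB θ n ∧ koszulDiff x b y = 0 ∧ coeffProj L 𝒜 0 y = 0}
  add_mem' {y z} hy hz := ⟨add_mem hy.1 hz.1, by rw [map_add, hy.2.1, hz.2.1, add_zero],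
    by rw [map_add, hy.2.2, hz.2.2, add_zero]⟩
  zero_mem' := ⟨zero_mem _, map_zero _, map_zero _⟩
  smul_mem' c y hy := ⟨Submodule.smul_mem _ c hy.1, by
    rw [Subalgebra.smul_def, map_smul, hy.2.1, smul_zero], by
    rw [Subalgebra.smul_def, coeffProj_zero_smul, hy.2.2, smul_zero]⟩

variable {hB : ∀ a, a ∈ B ↔ ∀ g, act g a = a}

variable [GradedAlgebra 𝒜]

theorem koszulDiff_mem_invariantCycles (h : IsEquivariantSystem 𝒜 act θ x b D) {n : ℕ}
    {y : A ⊗[k] ExteriorAlgebra k L} (hy : y ∈ invariantForms hB θ (n + 1)) :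
    koszulDiff x b y ∈ invariantCycles 𝒜 hB θ x b n :=
  ⟨koszulDiff_mem_invariantForms h hy, koszulDiff_koszulDiff h.comm y,
    coeffProj_zero_koszulDiff h.mem_one y⟩

theorem coeffProj_mem_invariantForms (h : IsEquivariantSystem 𝒜 act θ x b D) (m : ℕ) {n : ℕ}
    {y : A ⊗[k] ExteriorAlgebra k L} (hy : y ∈ invariantForms hB θ n) :
    coeffProj L 𝒜 m y ∈ invariantForms hB θ n :=
  ⟨fun g => by rw [diagAct_coeffProj h.act_mem, hy.1], by rw [← coeffProj_formProj, hy.2]⟩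

theorem exists_koszulDiff_eq_of_mem_invariantCycles [Finite G] [CharZero k]
    (h : IsEquivariantSystem 𝒜 act θ x b D) {n : ℕ} {y : A ⊗[k] ExteriorAlgebra k L}
    (hy : y ∈ invariantCycles 𝒜 hB θ x b n) :
    ∃ z ∈ invariantForms hB θ (n + 1), koszulDiff x b z = y := by
  obtain ⟨z, h1, h2, h3⟩ := h.exists_invariant_koszulDiff_eq hy.1.1 hy.1.2 hy.2.1 fun _ => hy.2.2
  exact ⟨z, ⟨h1, h2⟩, h3⟩

/-- In positive form degree every invariant cycle lies in `invariantCycles`. -/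
theorem mem_invariantCycles_succ [Finite G] [CharZero k]
    (h : IsEquivariantSystem 𝒜 act θ x b D) {n : ℕ} {y : A ⊗[k] ExteriorAlgebra k L}
    (hy : y ∈ invariantForms hB θ (n + 1)) (hd : koszulDiff x b y = 0) :
    y ∈ invariantCycles 𝒜 hB θ x b (n + 1) := by
  obtain ⟨z, -, -, rfl⟩ := h.exists_invariant_koszulDiff_eq hy.1 hy.2 hd (by simp)
  exact ⟨hy, hd, coeffProj_zero_koszulDiff h.mem_one z⟩

variable {κ : Type*} [Fintype κ] (δ : InvariantDualBasis 𝒜 act θ κ)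

variable (hB) in
/-- A functional of an invariant dual basis, on invariant forms. -/
noncomputable def InvariantDualBasis.invFunctional (n : ℕ) (j : κ) :
    invariantForms hB θ n →ₗ[B] B where
  toFun y := ⟨δ.functional j y, (hB _).2 fun g => by rw [δ.act_functional, y.2.1]⟩
  map_add' y z := Subtype.ext (map_add (δ.functional j) _ _)
  map_smul' c y := Subtype.ext (map_smul (δ.functional j) (c : A) (y : A ⊗[k] ExteriorAlgebra k L))

variable (hB) in
/-- The component of form degree `n` of a vector of an invariant dual basis. -/
noncomputable def InvariantDualBasis.invVec (n : ℕ) (j : κ) : invariantForms hB θ n :=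
  ⟨formProj k A L n (δ.vec j), fun g => by rw [diagAct_formProj, δ.diagAct_vec],
    formProj_formProj n _⟩

theorem InvariantDualBasis.sum_invFunctional_smul_invVec (n : ℕ) (y : invariantForms hB θ n) :
    ∑ j, δ.invFunctional hB n j y • δ.invVec hB n j = y := by
  apply Subtype.ext
  rw [AddSubmonoidClass.coe_finsetSum]
  conv_rhs => rw [← y.2.2, ← δ.sum_functional_smul_vec y.1, map_sum]
  refine Finset.sum_congr rfl fun j _ => ?_
  rw [map_smul]
  rfl

theorem InvariantDualBasis.coeffProj_invVec (n : ℕ) (j : κ) :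
    coeffProj L 𝒜 0 (δ.invVec hB n j : A ⊗[k] ExteriorAlgebra k L) = δ.invVec hB n j := by
  change coeffProj L 𝒜 0 (formProj k A L n (δ.vec j)) = formProj k A L n (δ.vec j)
  rw [coeffProj_formProj, δ.coeffProj_vec]

variable {ℬ : ℕ → Submodule k B} [GradedAlgebra ℬ]

theorem coe_proj_eq (hℬ : ∀ m c, c ∈ ℬ m ↔ (c : A) ∈ 𝒜 m) (m : ℕ) (c : B) :
    (GradedAlgebra.proj ℬ m c : A) = GradedAlgebra.proj 𝒜 m c :=
  GradedAlgebra.proj_map_of_mem ℬ 𝒜 B.val.toLinearMap (fun m c h => (hℬ m c).1 h) m c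

theorem mem_irrelevant_iff_coe (hℬ : ∀ m c, c ∈ ℬ m ↔ (c : A) ∈ 𝒜 m) (c : B) :
    c ∈ (HomogeneousIdeal.irrelevant ℬ).toIdeal ↔ GradedAlgebra.proj 𝒜 0 (c : A) = 0 := by
  rw [mem_irrelevant_iff_proj, ← coe_proj_eq hℬ, ZeroMemClass.coe_eq_zero]

theorem InvariantDualBasis.invFunctional_mem_irrelevant (hℬ : ∀ m c, c ∈ ℬ m ↔ (c : A) ∈ 𝒜 m)
    {n : ℕ} {y : invariantForms hB θ n}
    (hy : coeffProj L 𝒜 0 (y : A ⊗[k] ExteriorAlgebra k L) = 0) (j : κ) :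
    δ.invFunctional hB n j y ∈ (HomogeneousIdeal.irrelevant ℬ).toIdeal := by
  rw [mem_irrelevant_iff_coe hℬ]
  change GradedAlgebra.proj 𝒜 0 (δ.functional j y) = 0
  rw [δ.proj_functional, hy, map_zero]

end InvariantKoszul

/-! ### Forms of positive degree in the coefficients -/

section PositiveForms

variable {k : Type*} [Field k] {L : Type*} [AddCommGroup L] [Module k L] {I : Type*} [Fintype I]
  {G : Type*} [Group G] {A : Type*} [Ring A] [Algebra k A]
  {𝒜 : ℕ → Submodule k A} [GradedAlgebra 𝒜] {act : G →* (A →ₐ[k] A)}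
  {θ : Representation k G L} {x : L →ₗ[k] A} {b : Module.Basis I k L} {D : I → A →ₗ[k] A}
  {B : Subalgebra k A} {hB : ∀ a, a ∈ B ↔ ∀ g, act g a = a} {κ : Type*} [Fintype κ]

/-- The invariant forms of positive degree in the coefficient algebra `A`. -/
noncomputable def positiveForms (𝒜 : ℕ → Submodule k A) [GradedAlgebra 𝒜]
    (hB : ∀ a, a ∈ B ↔ ∀ g, act g a = a) (θ : Representation k G L) (n : ℕ) :
    Submodule B (invariantForms hB θ n) where
  carrier := {y | coeffProj L 𝒜 0 (y : A ⊗[k] ExteriorAlgebra k L) = 0}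
  add_mem' {y z} hy hz := by
    rw [Set.mem_ofPred_eq] at hy hz ⊢
    rw [Submodule.coe_add, map_add, hy, hz, add_zero]
  zero_mem' := map_zero _
  smul_mem' c y hy := by
    rw [Set.mem_ofPred_eq] at hy ⊢
    rw [Submodule.coe_smul, Subalgebra.smul_def, coeffProj_zero_smul, hy, smul_zero]

/-- The invariant forms of degree at least two in the coefficient algebra `A`. Multiplication by
`B_{≥ 1}` maps `positiveForms` into this submodule. -/
noncomputable def decomposableForms (𝒜 : ℕ → Submodule k A) [GradedAlgebra 𝒜]
    (hB : ∀ a, a ∈ B ↔ ∀ g, act g a = a) (θ : Representation k G L) (n : ℕ) :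
    Submodule B (invariantForms hB θ n) where
  carrier := {y | y ∈ positiveForms 𝒜 hB θ n ∧
    coeffProj L 𝒜 1 (y : A ⊗[k] ExteriorAlgebra k L) = 0}
  add_mem' {y z} hy hz := ⟨add_mem hy.1 hz.1, by
    rw [Submodule.coe_add, map_add, hy.2, hz.2, add_zero]⟩
  zero_mem' := ⟨zero_mem _, map_zero _⟩
  smul_mem' c y hy := ⟨Submodule.smul_mem _ c hy.1, by
    have h0 : coeffProj L 𝒜 0 (y : A ⊗[k] ExteriorAlgebra k L) = 0 := hy.1
    rw [Submodule.coe_smul, Subalgebra.smul_def, coeffProj_one_smul, hy.2, h0,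
      smul_zero, smul_zero, add_zero]⟩

variable {ℬ : ℕ → Submodule k B} [GradedAlgebra ℬ]

/-- A `B`-linear map from the Koszul cycles to `B₀` kills the cycles of degree at least two: they
are boundaries of positive forms, hence lie in `B_{≥ 1}` times the cycles. -/
theorem linearMap_invariantCycles_eq_zero [Finite G] [CharZero k]
    (h : IsEquivariantSystem 𝒜 act θ x b D) (δ : InvariantDualBasis 𝒜 act θ κ)
    (hℬ : ∀ m c, c ∈ ℬ m ↔ (c : A) ∈ 𝒜 m) {n : ℕ}
    (f : invariantCycles 𝒜 hB θ x b n →ₗ[B] B ⧸ (HomogeneousIdeal.irrelevant ℬ).toIdeal)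
    (y : invariantCycles 𝒜 hB θ x b n)
    (hy : coeffProj L 𝒜 1 (y : A ⊗[k] ExteriorAlgebra k L) = 0) : f y = 0 := by
  obtain ⟨z, hz, hzy⟩ := exists_koszulDiff_eq_of_mem_invariantCycles h y.2
  -- Removing the component of degree zero from `z` does not change `koszulDiff x b z`, as `y`
  -- has no component of degree one.
  let z' : invariantForms hB θ (n + 1) :=
    ⟨z, hz⟩ - ⟨coeffProj L 𝒜 0 z, coeffProj_mem_invariantForms h 0 hz⟩
  have hz'0 : coeffProj L 𝒜 0 (z' : A ⊗[k] ExteriorAlgebra k L) = 0 := by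
    change coeffProj L 𝒜 0 (z - coeffProj L 𝒜 0 z) = 0
    rw [map_sub, coeffProj_coeffProj, if_pos rfl, sub_self]
  have hz'd : koszulDiff x b (z' : A ⊗[k] ExteriorAlgebra k L) = y := by
    change koszulDiff x b (z - coeffProj L 𝒜 0 z) = y
    rw [map_sub, koszulDiff_coeffProj h.mem_one, hzy, zero_add, hy, sub_zero]
  -- The coefficients of `z'` in the dual basis have positive degree and so act by zero on `B₀`.
  have hsum : y = ∑ j, δ.invFunctional hB (n + 1) j z' •
      (⟨koszulDiff x b (δ.invVec hB (n + 1) j : A ⊗[k] ExteriorAlgebra k L),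
        koszulDiff_mem_invariantCycles h (δ.invVec hB (n + 1) j).2⟩ :
          invariantCycles 𝒜 hB θ x b n) := by
    apply Subtype.ext
    rw [← hz'd, AddSubmonoidClass.coe_finsetSum]
    conv_lhs => rw [← δ.sum_invFunctional_smul_invVec (n + 1) z', AddSubmonoidClass.coe_finsetSum,
      map_sum]
    refine Finset.sum_congr rfl fun j _ => ?_
    rw [Submodule.coe_smul, Submodule.coe_smul, Subalgebra.smul_def, map_smul]
    rfl
  have := irrelevant_isTwoSided ℬ
  rw [hsum, map_sum]
  refine Finset.sum_eq_zero fun j _ => ?_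
  rw [map_smul]
  obtain ⟨c, hc⟩ := Submodule.mkQ_surjective _ (f ⟨koszulDiff x b (δ.invVec hB (n + 1) j),
    koszulDiff_mem_invariantCycles h (δ.invVec hB (n + 1) j).2⟩)
  rw [← hc, ← map_smul, Submodule.mkQ_apply, Submodule.Quotient.mk_eq_zero, smul_eq_mul]
  exact Ideal.mul_mem_right _ _ (δ.invFunctional_mem_irrelevant hℬ hz'0 j)

/-- Every `B`-linear map from the Koszul cycles to `B₀` extends to the forms of positive degree. It
kills the cycles of degree at least two, and the quotient of the positive forms by those of degree
at least two is semisimple. -/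
theorem exists_extension_to_positiveForms [Finite G] [CharZero k] [IsSemisimpleRing (ℬ 0)]
    (h : IsEquivariantSystem 𝒜 act θ x b D) (δ : InvariantDualBasis 𝒜 act θ κ)
    (hℬ : ∀ m c, c ∈ ℬ m ↔ (c : A) ∈ 𝒜 m) {n : ℕ}
    (f : invariantCycles 𝒜 hB θ x b n →ₗ[B] B ⧸ (HomogeneousIdeal.irrelevant ℬ).toIdeal) :
    ∃ f' : positiveForms 𝒜 hB θ n →ₗ[B] B ⧸ (HomogeneousIdeal.irrelevant ℬ).toIdeal,
      ∀ y : invariantCycles 𝒜 hB θ x b n, f' ⟨⟨y, y.2.1⟩, y.2.2.2⟩ = f y := by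
  refine exists_extension_of_irrelevant_smul_mem ℬ
    (Submodule.inclusion fun y hy => hy.1 :
      invariantCycles 𝒜 hB θ x b n →ₗ[B] invariantForms hB θ n)
    (positiveForms 𝒜 hB θ n) (decomposableForms 𝒜 hB θ n) (fun y => y.2.2.2)
    (fun c hc y hy => ⟨Submodule.smul_mem _ c hy, ?_⟩) f fun y hy => ?_
  · rw [mem_irrelevant_iff_coe hℬ] at hc
    change coeffProj L 𝒜 1 ((c : A) • (y : A ⊗[k] ExteriorAlgebra k L)) = 0
    have h0 : coeffProj L 𝒜 0 (y : A ⊗[k] ExteriorAlgebra k L) = 0 := hy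
    rw [coeffProj_one_smul, hc, h0, zero_smul, smul_zero, add_zero]
  · exact linearMap_invariantCycles_eq_zero h δ hℬ f y hy.2

theorem formCounit_mem (y : invariantForms hB θ 0) :
    formCounit k A L (y : A ⊗[k] ExteriorAlgebra k L) ∈ B :=
  (hB _).2 fun g => by rw [← formCounit_diagAct (θ := θ), y.2.1]

theorem tmul_one_mem_invariantForms (c : B) :
    (c : A) ⊗ₜ[k] (1 : ExteriorAlgebra k L) ∈ invariantForms hB θ 0 :=
  ⟨fun g => by rw [diagAct_tmul, (hB c).1 c.2, map_one],
    by rw [formProj_zero, formCounit_tmul_one]⟩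

theorem koszulDiff_tmul_one (a : A) :
    koszulDiff x b (a ⊗ₜ[k] (1 : ExteriorAlgebra k L)) = 0 := by
  have : ∀ φ, CliffordAlgebra.contractLeft (Q := (0 : QuadraticForm k L)) φ
      (1 : ExteriorAlgebra k L) = 0 := fun φ => CliffordAlgebra.contractLeft_one _ φ
  rw [koszulDiff_tmul]
  exact Finset.sum_eq_zero fun i _ => by rw [this, TensorProduct.tmul_zero]

/-- The algebra of invariants is generated in degrees `0` and `1`: by exactness of the Koszul
complex every invariant of degree `m + 1` is a sum of products of invariants of degrees `m`
and `1`. -/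
theorem adjoin_zero_one_eq_top [Finite G] [CharZero k] (hB : ∀ a, a ∈ B ↔ ∀ g, act g a = a)
    (h : IsEquivariantSystem 𝒜 act θ x b D) (δ : InvariantDualBasis 𝒜 act θ κ)
    (hℬ : ∀ m c, c ∈ ℬ m ↔ (c : A) ∈ 𝒜 m) :
    Algebra.adjoin k ((ℬ 0 : Set B) ∪ (ℬ 1 : Set B)) = ⊤ := by
  have key : ∀ m, ∀ c ∈ ℬ m, c ∈ Algebra.adjoin k ((ℬ 0 : Set B) ∪ (ℬ 1 : Set B)) := by
    intro m
    induction m with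
    | zero => exact fun c hc => Algebra.subset_adjoin (Or.inl hc)
    | succ m ih =>
      intro c hc
      have hc' := (hℬ _ _).1 hc
      obtain ⟨z, hz, hzc⟩ := exists_koszulDiff_eq_of_mem_invariantCycles (hB := hB) (n := 0) h
        (y := (c : A) ⊗ₜ 1) ⟨tmul_one_mem_invariantForms c, koszulDiff_tmul_one _, by
          rw [coeffProj_tmul, GradedAlgebra.proj_apply,
            DirectSum.decompose_of_mem_ne _ hc' (by simp), TensorProduct.zero_tmul]⟩
      let z' : invariantForms hB θ 1 := ⟨coeffProj L 𝒜 m z, coeffProj_mem_invariantForms h m hz⟩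
      have hz' : koszulDiff x b (z' : A ⊗[k] ExteriorAlgebra k L) = (c : A) ⊗ₜ 1 := by
        change koszulDiff x b (coeffProj L 𝒜 m z) = _
        rw [koszulDiff_coeffProj h.mem_one, hzc, coeffProj_tmul, GradedAlgebra.proj_apply,
          DirectSum.decompose_of_mem_same _ hc']
      let w : κ → invariantForms hB θ 0 := fun j =>
        ⟨koszulDiff x b (δ.invVec hB 1 j : A ⊗[k] ExteriorAlgebra k L),
          koszulDiff_mem_invariantForms h (δ.invVec hB 1 j).2⟩
      have hsum : c = ∑ j, δ.invFunctional hB 1 j z' * ⟨formCounit k A L (w j),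
          formCounit_mem (w j)⟩ := by
        apply Subtype.ext
        rw [AddSubmonoidClass.coe_finsetSum]
        refine (formCounit_tmul_one (k := k) (L := L) (c : A)).symm.trans ?_
        rw [← hz']
        conv_lhs => rw [← δ.sum_invFunctional_smul_invVec 1 z', AddSubmonoidClass.coe_finsetSum,
          map_sum, map_sum]
        refine Finset.sum_congr rfl fun j _ => ?_
        rw [Submodule.coe_smul, Subalgebra.smul_def, map_smul, map_smul]
        rfl
      rw [hsum]
      refine sum_mem fun j _ => mul_mem (ih _ ?_) (Algebra.subset_adjoin (Or.inr ?_))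
      · rw [hℬ]
        change δ.functional j (coeffProj L 𝒜 m z) ∈ 𝒜 m
        rw [← δ.proj_functional]
        exact SetLike.coe_mem _
      · change _ ∈ ℬ 1
        rw [hℬ]
        change formCounit k A L (koszulDiff x b (δ.invVec hB 1 j : A ⊗[k] ExteriorAlgebra k L)) ∈ _
        rw [← δ.coeffProj_invVec, koszulDiff_coeffProj h.mem_one, formCounit_coeffProj]
        exact SetLike.coe_mem _
  rw [eq_top_iff]
  rintro c -
  induction c using DirectSum.Decomposition.inductionOn ℬ with
  | zero => exact zero_mem _
  | add c c' hc hc' => exact add_mem hc hc'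
  | homogeneous c => exact key _ c c.2

end PositiveForms

/-! ### The Koszul resolution and the Ext algebra -/

section InvariantKoszulExt

variable {k : Type w} [Field k] {L : Type v} [AddCommGroup L] [Module k L] {I : Type*} [Fintype I]
  {G : Type*} [Group G] {A : Type max u v w} [Ring A] [Algebra k A]
  {𝒜 : ℕ → Submodule k A} [GradedAlgebra 𝒜] {act : G →* (A →ₐ[k] A)}
  {θ : Representation k G L} {x : L →ₗ[k] A} {b : Module.Basis I k L} {D : I → A →ₗ[k] A}
  {B : Subalgebra k A} {hB : ∀ a, a ∈ B ↔ ∀ g, act g a = a} {κ : Type*} [Fintype κ]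

variable {ℬ : ℕ → Submodule k B} [GradedAlgebra ℬ]

/-- Dimension shifting along the projective module of invariant `n`-forms, for any quotient `M` of
it by the Koszul cycles. -/
theorem extSpannedByDegreeOne_of_invariantCycles [Finite G] [CharZero k] [IsSemisimpleRing (ℬ 0)]
    (h : IsEquivariantSystem 𝒜 act θ x b D) (δ : InvariantDualBasis 𝒜 act θ κ)
    (hℬ : ∀ m c, c ∈ ℬ m ↔ (c : A) ∈ 𝒜 m) {n m : ℕ} {M : Type max u v w}
    [AddCommGroup M] [Module B M] (q : invariantForms hB θ n →ₗ[B] M) (hq : Function.Surjective q)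
    (hker : ∀ y, q y = 0 ↔ (y : A ⊗[k] ExteriorAlgebra k L) ∈ invariantCycles 𝒜 hB θ x b n)
    (hm : ExtSpannedByDegreeOne.{max u v w} (degreeZeroModule ℬ)
      (ModuleCat.of B (invariantCycles 𝒜 hB θ x b n)) m) :
    ExtSpannedByDegreeOne.{max u v w} (degreeZeroModule ℬ) (ModuleCat.of B M) (m + 1) := by
  refine extSpannedByDegreeOne_succ_of_dualBasis (HomogeneousIdeal.irrelevant ℬ).toIdeal
    (Submodule.inclusion fun y hy => hy.1 :
      invariantCycles 𝒜 hB θ x b n →ₗ[B] invariantForms hB θ n) q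
    (Submodule.inclusion_injective _) hq (fun y => ?_) (positiveForms 𝒜 hB θ n)
    (fun y => y.2.2.2) (fun f => exists_extension_to_positiveForms h δ hℬ f)
    (fun j => δ.invFunctional hB n j) (fun j => δ.invVec hB n j)
    (fun y => δ.sum_invFunctional_smul_invVec n y)
    (fun j y hy => δ.invFunctional_mem_irrelevant hℬ hy j) (fun j c hc => ?_) hm
  · rw [hker]
    exact ⟨fun hy => ⟨⟨y, hy⟩, rfl⟩, fun ⟨z, hz⟩ => hz ▸ z.2⟩
  · rw [mem_irrelevant_iff_coe hℬ] at hc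
    change coeffProj L 𝒜 0 ((c : A) • (δ.invVec hB n j : A ⊗[k] ExteriorAlgebra k L)) = 0
    rw [coeffProj_zero_smul, hc, zero_smul]

/-- The modules `invariantCycles` are the higher syzygies of `B₀`: by exactness the module of
invariant `(n + 1)`-forms maps onto the cycles in degree `n`, and its kernel is the module of cycles
in degree `n + 1`. -/
theorem extSpannedByDegreeOne_invariantCycles [Finite G] [CharZero k] [IsSemisimpleRing (ℬ 0)]
    (h : IsEquivariantSystem 𝒜 act θ x b D) (δ : InvariantDualBasis 𝒜 act θ κ)
    (hℬ : ∀ m c, c ∈ ℬ m ↔ (c : A) ∈ 𝒜 m) (m n : ℕ) :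
    ExtSpannedByDegreeOne.{max u v w} (degreeZeroModule ℬ)
      (ModuleCat.of B (invariantCycles 𝒜 hB θ x b n)) m := by
  induction m generalizing n with
  | zero => exact extSpannedByDegreeOne_zero _ _
  | succ m ih =>
    let q : invariantForms hB θ (n + 1) →ₗ[B] invariantCycles 𝒜 hB θ x b n :=
      { toFun := fun y => ⟨koszulDiff x b y, koszulDiff_mem_invariantCycles h y.2⟩
        map_add' := fun y z => Subtype.ext (map_add (koszulDiff x b) _ _)
        map_smul' := fun c y => Subtype.ext (map_smul (koszulDiff x b) (c : A)
          (y : A ⊗[k] ExteriorAlgebra k L)) }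
    refine extSpannedByDegreeOne_of_invariantCycles.{w, v, u} h δ hℬ q (fun y => ?_) (fun y => ?_)
      (ih (n + 1))
    · obtain ⟨z, hz, hzy⟩ := exists_koszulDiff_eq_of_mem_invariantCycles h y.2
      exact ⟨⟨z, hz⟩, Subtype.ext hzy⟩
    · exact ⟨fun hy => mem_invariantCycles_succ h y.2 (congrArg Subtype.val hy),
        fun hy => Subtype.ext hy.2.1⟩

/-- The Ext algebra of the degree-zero part of the algebra of invariants is generated in
degree one. The invariant `0`-forms are a copy of `B`, and the first syzygy of `B₀` is
`invariantCycles` for `n = 0`. -/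
theorem extAlgebraGeneratedInDegreeOne_degreeZeroModule [Finite G] [CharZero k]
    [IsSemisimpleRing (ℬ 0)] (hB : ∀ a, a ∈ B ↔ ∀ g, act g a = a)
    (h : IsEquivariantSystem 𝒜 act θ x b D) (δ : InvariantDualBasis 𝒜 act θ κ)
    (hℬ : ∀ m c, c ∈ ℬ m ↔ (c : A) ∈ 𝒜 m) :
    ExtAlgebraGeneratedInDegreeOne.{max u v w} (degreeZeroModule ℬ) := by
  intro n α
  refine ExtSpannedByDegreeOne.inExtSubalgebra ?_ α
  rcases n with _ | n
  · exact extSpannedByDegreeOne_zero _ _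
  let q : invariantForms hB θ 0 →ₗ[B] B :=
    { toFun := fun y => ⟨formCounit k A L y, formCounit_mem y⟩
      map_add' := fun y z => Subtype.ext (map_add (formCounit k A L) _ _)
      map_smul' := fun c y => Subtype.ext (map_smul (formCounit k A L) (c : A)
        (y : A ⊗[k] ExteriorAlgebra k L)) }
  refine extSpannedByDegreeOne_of_invariantCycles.{w, v, u} h δ hℬ
    ((HomogeneousIdeal.irrelevant ℬ).toIdeal.mkQ ∘ₗ q) (fun c => ?_) (fun y => ?_)
    (extSpannedByDegreeOne_invariantCycles.{w, v, u} h δ hℬ n 0)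
  · obtain ⟨c, rfl⟩ := Submodule.mkQ_surjective _ c
    exact ⟨⟨(c : A) ⊗ₜ 1, tmul_one_mem_invariantForms c⟩,
      congrArg (HomogeneousIdeal.irrelevant ℬ).toIdeal.mkQ
        (Subtype.ext (formCounit_tmul_one (k := k) (L := L) (c : A)))⟩
  · have hy : (y : A ⊗[k] ExteriorAlgebra k L) = formCounit k A L y ⊗ₜ 1 := by
      rw [← formProj_zero, y.2.2]
    rw [LinearMap.comp_apply, Submodule.mkQ_apply, Submodule.Quotient.mk_eq_zero,
      mem_irrelevant_iff_coe hℬ]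
    change GradedAlgebra.proj 𝒜 0 (formCounit k A L (y : A ⊗[k] ExteriorAlgebra k L)) = 0 ↔ _
    refine ⟨fun h0 => ⟨y.2, ?_, ?_⟩, fun h0 => ?_⟩
    · rw [hy, koszulDiff_tmul_one]
    · rw [hy, coeffProj_tmul, h0, TensorProduct.zero_tmul]
    · rw [← formCounit_coeffProj, h0.2.2, map_zero]

end InvariantKoszulExt

/-! ### Complete families of irreducible representations -/

section CompleteFamily

open scoped MonoidAlgebra
open Representation

variable {G : Type*} [Group G]

theorem nonempty_equiv_of_asModule_linearEquiv {k : Type*} [CommRing k] {M N : Type*}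
    [AddCommGroup M] [Module k M] [AddCommGroup N] [Module k N] {ρ : Representation k G M}
    {σ : Representation k G N} (e : ρ.asModule ≃ₗ[k[G]] σ.asModule) : Nonempty (ρ.Equiv σ) :=
  ⟨((IntertwiningMap.equivLinearMapAsModule ρ σ).symm e.toLinearMap).ofBijective e.bijective⟩

theorem Representation.IsIrreducible.finiteDimensional {k : Type*} [Field k] [Finite G] {M : Type*}
    [AddCommGroup M] [Module k M] (ρ : Representation k G M) [ρ.IsIrreducible] :
    FiniteDimensional k M := by
  have : Module.Finite k ρ.asModule := Module.Finite.trans k[G] ρ.asModule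
  exact this

variable [Finite G] {ι : Type*} {U : ι → Type*} [∀ i, AddCommGroup (U i)] [∀ i, Module ℂ (U i)]
  {σ : ∀ i, Representation ℂ G (U i)}

/-- A finite group has finitely many irreducible representations: they inject into the isotypic
components of the group algebra. -/
theorem IsCompleteIrreducibleFamily.finite_index (hσ : IsCompleteIrreducibleFamily σ) :
    Finite ι := by
  have := hσ.irreducible
  choose J hJ using fun i =>
    IsSemisimpleRing.exists_linearEquiv_ideal_of_isSimpleModule ℂ[G] (σ i).asModule
  have hs : ∀ i, IsSimpleModule ℂ[G] (J i) := fun i => IsSimpleModule.congr (hJ i).some.symm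
  refine Finite.of_injective
    (fun i => (⟨isotypicComponent ℂ[G] ℂ[G] (J i), J i, hs i, rfl⟩ :
      isotypicComponents ℂ[G] ℂ[G])) fun i j hij => ?_
  have h1 : J i ≤ isotypicComponent ℂ[G] ℂ[G] (J j) :=
    (Submodule.le_isotypicComponent (J i)).trans (congrArg Subtype.val hij).le
  obtain ⟨e⟩ := isIsotypicOfType_submodule_iff.1 (.isotypicComponent ℂ[G] ℂ[G] (J j)) _ h1
  exact hσ.pairwise_not_equiv i j
    (nonempty_equiv_of_asModule_linearEquiv ((hJ i).some.trans (e.trans (hJ j).some.symm)))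

/-- The sum of all irreducible representations is finite-dimensional. -/
theorem IsCompleteIrreducibleFamily.finiteDimensional_directSum
    (hσ : IsCompleteIrreducibleFamily σ) : FiniteDimensional ℂ (⨁ i, U i) := by
  have := hσ.finite_index
  have := fun i => (hσ.irreducible i)
  have := fun i => IsIrreducible.finiteDimensional (σ i)
  have := Fintype.ofFinite ι
  classical
  exact Module.Finite.equiv (DirectSum.linearEquivFunOnFintype ℂ ι U).symm

/-- Every simple module over the group algebra is one of the given irreducible representations. -/
theorem IsCompleteIrreducibleFamily.exists_linearEquiv (hσ : IsCompleteIrreducibleFamily σ)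
    {S : Type*} [AddCommGroup S] [Module ℂ S] [Module ℂ[G] S] [IsScalarTower ℂ ℂ[G] S]
    [IsSimpleModule ℂ[G] S] : ∃ i, Nonempty (S ≃ₗ[ℂ[G]] (σ i).asModule) := by
  have : FiniteDimensional ℂ S := Module.Finite.trans ℂ[G] S
  let e : S ≃ₗ[ℂ] (Fin (Module.finrank ℂ S) → ℂ) := (Module.finBasis ℂ S).equivFun
  -- Completeness is only tested on representations in the lowest universe.
  let τ : Representation ℂ G (Fin (Module.finrank ℂ S) → ℂ) :=
    { toFun := fun g => e.toLinearMap ∘ₗ ofModule' S g ∘ₗ e.symm.toLinearMap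
      map_one' := by ext; simp
      map_mul' := fun g h => LinearMap.ext fun x => by simp }
  have hτ : ∀ g s, τ g (e s) = e (MonoidAlgebra.single g (1 : ℂ) • s) := by
    intro g s
    simp [τ, ofModule']
  let f : S →ₗ[ℂ[G]] τ.asModule := MonoidAlgebra.equivariantOfLinearOfComm
    (τ.asModuleEquiv.symm.toLinearMap ∘ₗ e.toLinearMap) fun g s => by
      rw [LinearMap.comp_apply, LinearMap.comp_apply]
      apply τ.asModuleEquiv.injective
      simp only [LinearEquiv.coe_coe, LinearEquiv.apply_symm_apply, asModuleEquiv_map_smul,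
        asAlgebraHom_single_one, hτ]
  let E : S ≃ₗ[ℂ[G]] τ.asModule :=
    LinearEquiv.ofBijective f (e.trans τ.asModuleEquiv.symm).bijective
  have : IsSimpleModule ℂ[G] τ.asModule := IsSimpleModule.congr E.symm
  obtain ⟨i, ⟨φ⟩⟩ := hσ.complete _ τ ((irreducible_iff_isSimpleModule_asModule τ).2 this)
  exact ⟨i, ⟨E.trans (LinearEquiv.ofBijective
    (IntertwiningMap.equivLinearMapAsModule τ (σ i) φ.toIntertwiningMap)
    φ.toLinearEquiv.bijective)⟩⟩

/-- Every finite-dimensional representation is a direct summand of a multiple of the sum of all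
irreducible representations. -/
theorem IsCompleteIrreducibleFamily.exists_sum_comp_eq_id (hσ : IsCompleteIrreducibleFamily σ)
    {N : Type*} [AddCommGroup N] [Module ℂ N] [FiniteDimensional ℂ N] (τ : Representation ℂ G N) :
    ∃ (n : ℕ) (a : Fin n → (⨁ i, U i) →ₗ[ℂ] N) (b : Fin n → N →ₗ[ℂ] ⨁ i, U i),
      (∀ j g, a j ∘ₗ directSum σ g = τ g ∘ₗ a j) ∧
      (∀ j g, b j ∘ₗ τ g = directSum σ g ∘ₗ b j) ∧ ∑ j, a j ∘ₗ b j = LinearMap.id := by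
  classical
  have : Module.Finite ℂ τ.asModule := inferInstance
  have : Module.Finite ℂ[G] τ.asModule := Module.Finite.of_restrictScalars_finite ℂ _ _
  obtain ⟨n, S, e, hS⟩ := IsSemisimpleModule.exists_linearEquiv_fin_dfinsupp ℂ[G] τ.asModule
  choose i hi using fun j => hσ.exists_linearEquiv (S := S j)
  let incl : ∀ i, (σ i).asModule →ₗ[ℂ[G]] (directSum σ).asModule := fun i =>
    IntertwiningMap.equivLinearMapAsModule (σ i) (directSum σ)
      { toLinearMap := DirectSum.lof ℂ ι U i
        isIntertwining' := fun g => by ext x; simp [directSum] }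
  let proj : ∀ i, (directSum σ).asModule →ₗ[ℂ[G]] (σ i).asModule := fun i =>
    IntertwiningMap.equivLinearMapAsModule (directSum σ) (σ i)
      { toLinearMap := DirectSum.component ℂ ι U i
        isIntertwining' := fun g =>
          LinearMap.ext fun x =>
            DFinsupp.mapRange_apply (fun i => σ i g) (fun i => map_zero (σ i g)) x i }
  have hpi : ∀ i x, proj i (incl i x) = x := fun i x => DirectSum.component.lof_self ℂ i x
  let a : Fin n → (directSum σ).asModule →ₗ[ℂ[G]] τ.asModule := fun j =>
    e.symm.toLinearMap ∘ₗ DFinsupp.lsingle j ∘ₗ (hi j).some.symm.toLinearMap ∘ₗ proj (i j)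
  let b : Fin n → τ.asModule →ₗ[ℂ[G]] (directSum σ).asModule := fun j =>
    incl (i j) ∘ₗ (hi j).some.toLinearMap ∘ₗ DFinsupp.lapply j ∘ₗ e.toLinearMap
  refine ⟨n, fun j => ((IntertwiningMap.equivLinearMapAsModule _ _).symm (a j)).toLinearMap,
    fun j => ((IntertwiningMap.equivLinearMapAsModule _ _).symm (b j)).toLinearMap,
    fun j g => IntertwiningMap.isIntertwining' _ g, fun j g => IntertwiningMap.isIntertwining' _ g,
    ?_⟩
  ext x
  rw [LinearMap.sum_apply]
  have hab : ∀ j, a j (b j x) = e.symm (DFinsupp.single j (e x j)) := by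
    intro j
    have h := congrArg (hi j).some.symm (hpi (i j) ((hi j).some (e x j)))
    rw [LinearEquiv.symm_apply_apply] at h
    exact congrArg (fun y => e.symm (DFinsupp.single j y)) h
  refine (Finset.sum_congr rfl fun j _ => hab j).trans ?_
  rw [← map_sum, show ∑ j, DFinsupp.single j (e x j) = e x from ?_]
  · exact e.symm_apply_apply x
  · ext j
    simp [DFinsupp.single_apply]

end CompleteFamily

/-! ### Partial derivatives of the symmetric algebra -/

section SymmetricAlgebra

variable {k : Type*} [CommRing k] {M : Type*} [AddCommGroup M] [Module k M] {I : Type*}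

/-- The partial derivative of the symmetric algebra along the `i`-th vector of a basis. -/
noncomputable def SymmetricAlgebra.partialDeriv (b : Module.Basis I k M) (i : I) :
    SymmetricAlgebra k M →ₗ[k] SymmetricAlgebra k M :=
  (SymmetricAlgebra.equivMvPolynomial b).symm.toLinearMap ∘ₗ
    (MvPolynomial.pderiv i).toLinearMap ∘ₗ (SymmetricAlgebra.equivMvPolynomial b).toLinearMap

namespace SymmetricAlgebra

variable (b : Module.Basis I k M)

theorem equivMvPolynomial_partialDeriv (i : I) (s : SymmetricAlgebra k M) :
    equivMvPolynomial b (partialDeriv b i s) = MvPolynomial.pderiv i (equivMvPolynomial b s) := by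
  simp [partialDeriv]

theorem partialDeriv_mul_ι_self (i : I) (s : SymmetricAlgebra k M) :
    partialDeriv b i (s * ι k M (b i)) = partialDeriv b i s * ι k M (b i) + s := by
  apply (equivMvPolynomial b).injective
  simp only [equivMvPolynomial_partialDeriv, map_mul, map_add, equivMvPolynomial_ι_apply,
    Derivation.leibniz, MvPolynomial.pderiv_X_self, smul_eq_mul]
  ring

theorem partialDeriv_mul_ι_of_ne {i j : I} (h : i ≠ j) (s : SymmetricAlgebra k M) :
    partialDeriv b i (s * ι k M (b j)) = partialDeriv b i s * ι k M (b j) := by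
  apply (equivMvPolynomial b).injective
  simp only [equivMvPolynomial_partialDeriv, map_mul, equivMvPolynomial_ι_apply,
    Derivation.leibniz, MvPolynomial.pderiv_X_of_ne h.symm, smul_eq_mul]
  ring

theorem isHomogeneous_equivMvPolynomial [Fintype I] {m : ℕ} {s : SymmetricAlgebra k M}
    (hs : s ∈ symPiece k M m) : (equivMvPolynomial b s).IsHomogeneous m := by
  unfold symPiece at hs
  induction hs using Submodule.pow_induction_on_left' with
  | algebraMap r =>
    rw [AlgEquiv.commutes]
    exact MvPolynomial.isHomogeneous_C I r
  | add x y i hx hy ihx ihy => rw [map_add]; exact ihx.add ihy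
  | mem_mul y hy i x hx ih =>
    obtain ⟨l, rfl⟩ := hy
    rw [map_mul, Nat.succ_eq_one_add]
    refine MvPolynomial.IsHomogeneous.mul ?_ ih
    rw [← b.sum_repr l, map_sum, map_sum]
    refine MvPolynomial.IsHomogeneous.sum _ _ _ fun j _ => ?_
    rw [map_smul, map_smul, equivMvPolynomial_ι_apply, MvPolynomial.smul_eq_C_mul]
    exact (MvPolynomial.isHomogeneous_X k j).C_mul _

/-- Euler's identity. -/
theorem sum_partialDeriv_mul_ι [Fintype I] {m : ℕ} {s : SymmetricAlgebra k M}
    (hs : s ∈ symPiece k M m) : ∑ i, partialDeriv b i s * ι k M (b i) = (m : k) • s := by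
  apply (equivMvPolynomial b).injective
  simp only [map_sum, map_mul, equivMvPolynomial_partialDeriv, equivMvPolynomial_ι_apply, map_smul]
  rw [Nat.cast_smul_eq_nsmul, ← (isHomogeneous_equivMvPolynomial b hs).sum_X_mul_pderiv]
  exact Finset.sum_congr rfl fun i _ => mul_comm _ _

end SymmetricAlgebra

end SymmetricAlgebra

/-! ### The equivariant system on the symmetric algebra tensored with endomorphisms -/

section InvariantAlgebra

variable {k : Type*} [Field k] {G : Type*} [Group G]
  {V : Type*} [AddCommGroup V] [Module k V] {W : Type*} [AddCommGroup W] [Module k W]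

/-- `S^• V^* ⊗ End(W)^op` is graded by the degree in `S^• V^*`. -/
noncomputable instance symTensorEndOpPiece.gradedAlgebra :
    GradedAlgebra (symTensorEndOpPiece k V W) where
  __ := symTensorEndOpPiece.gradedMonoid
  __ := DirectSum.IsInternal.chooseDecomposition _ (by
    rw [DirectSum.isInternal_submodule_iff_iSupIndep_and_iSup_eq_top]
    constructor
    · intro d
      rw [Submodule.disjoint_def]
      intro x hx hx'
      have h0 : (⨆ (j : ℕ) (_ : j ≠ d), symTensorEndOpPiece k V W j) ≤
          LinearMap.ker (symTensorEndOpProj k V W d) :=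
        iSup₂_le fun j hj y hy => symTensorEndOpProj_ne hj hy
      exact (symTensorEndOpProj_same hx).symm.trans (h0 hx')
    · rw [eq_top_iff]
      rintro x -
      obtain ⟨N, hN⟩ := exists_sum_symTensorEndOpProj x
      rw [← hN N le_rfl]
      exact Submodule.sum_mem _ fun d _ =>
        Submodule.mem_iSup_of_mem d (symTensorEndOpProj_mem d _))

theorem symDualAct_one (ρ : Representation k G V) : symDualAct ρ 1 = AlgHom.id k _ :=
  SymmetricAlgebra.algHom_ext (by ext l : 1; simp [symDualAct]; rfl)

theorem symDualAct_mul (ρ : Representation k G V) (g h : G) :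
    symDualAct ρ (g * h) = (symDualAct ρ g).comp (symDualAct ρ h) :=
  SymmetricAlgebra.algHom_ext (by ext l : 1; simp [symDualAct]; rfl)

theorem symTensorEndOpAct_tmul (ρ : Representation k G V) (σ : Representation k G W) (g : G)
    (s : SymmetricAlgebra k (Module.Dual k V)) (f : (Module.End k W)ᵐᵒᵖ) :
    symTensorEndOpAct ρ σ g (s ⊗ₜ f) =
      symDualAct ρ g s ⊗ₜ MulOpposite.op (Representation.linHom σ σ g f.unop) :=
  rfl

/-- The action of `G` on `S^• V^* ⊗ End(W)^op` as a homomorphism. -/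
noncomputable def symTensorEndOpActHom (ρ : Representation k G V) (σ : Representation k G W) :
    G →* (SymTensorEndOp k V W →ₐ[k] SymTensorEndOp k V W) where
  toFun := symTensorEndOpAct ρ σ
  map_one' := AlgHom.ext fun a => by
    induction a using TensorProduct.induction_on with
    | zero => simp
    | add a a' h h' => simp only [map_add, h, h']
    | tmul s f => simp [symTensorEndOpAct_tmul, symDualAct_one]
  map_mul' g h := AlgHom.ext fun a => by
    induction a using TensorProduct.induction_on with
    | zero => simp
    | add a a' h h' => simp only [map_add, h, h']
    | tmul s f => simp [symTensorEndOpAct_tmul, symDualAct_mul]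

/-- The inclusion of `V^*` in `S^• V^* ⊗ End(W)^op`. -/
noncomputable def dualToSymTensorEndOp : Module.Dual k V →ₗ[k] SymTensorEndOp k V W :=
  (TensorProduct.mk k _ _).flip 1 ∘ₗ SymmetricAlgebra.ι k (Module.Dual k V)

theorem isEquivariantSystem_symTensorEndOp {I : Type*} [Fintype I] (ρ : Representation k G V)
    (σ : Representation k G W) (b : Module.Basis I k (Module.Dual k V)) :
    IsEquivariantSystem (symTensorEndOpPiece k V W) (symTensorEndOpActHom ρ σ) ρ.dual
      dualToSymTensorEndOp b
      fun i => (SymmetricAlgebra.partialDeriv b i).rTensor (Module.End k W)ᵐᵒᵖ where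
  mem_one l := tmul_mem_symTensorEndOpPiece (symPiece.ι_mem k _ l) 1
  comm l l' := by
    simp [dualToSymTensorEndOp, mul_comm]
  apply_mul_self i a := by
    induction a using TensorProduct.induction_on with
    | zero => simp
    | add a a' h h' => simp only [add_mul, map_add, h, h']; abel
    | tmul s f =>
      simp [dualToSymTensorEndOp, SymmetricAlgebra.partialDeriv_mul_ι_self, TensorProduct.add_tmul]
  apply_mul_ne i j a hij := by
    induction a using TensorProduct.induction_on with
    | zero => simp
    | add a a' h h' => simp only [add_mul, map_add, h, h']
    | tmul s f =>
      simp [dualToSymTensorEndOp, SymmetricAlgebra.partialDeriv_mul_ι_of_ne b hij]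
  euler m a ha := by
    have h : symTensorEndOpPiece k V W m ≤ LinearMap.eqLocus
        (∑ i, LinearMap.mulRight k (dualToSymTensorEndOp (b i)) ∘ₗ
          (SymmetricAlgebra.partialDeriv b i).rTensor (Module.End k W)ᵐᵒᵖ)
        ((m : k) • LinearMap.id) := symTensorEndOpPiece_le fun s hs f => by
      simp only [LinearMap.mem_eqLocus, LinearMap.sum_apply, LinearMap.comp_apply,
        LinearMap.rTensor_tmul, LinearMap.mulRight_apply, dualToSymTensorEndOp,
        LinearMap.flip_apply, TensorProduct.mk_apply, Algebra.TensorProduct.tmul_mul_tmul, mul_one,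
        ← TensorProduct.sum_tmul, SymmetricAlgebra.sum_partialDeriv_mul_ι b hs]
      rfl
    simpa using h ha
  act_mem g _ _ ha := symTensorEndOpAct_mem ρ σ g ha
  act_apply g l := by
    simp [symTensorEndOpActHom, symTensorEndOpAct, dualToSymTensorEndOp, symDualAct]

end InvariantAlgebra

/-! ### Semisimplicity of the invariants of degree zero -/

section DegreeZero

open scoped MonoidAlgebra
open Representation

variable {k : Type*} [Field k] {G : Type*} [Group G]
  {V : Type*} [AddCommGroup V] [Module k V] {W : Type*} [AddCommGroup W] [Module k W]
  (ρ : Representation k G V) (σ : Representation k G W)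

/-- The degree zero part of `S^• V^* ⊗ End(W)^op` is `End(W)^op`. -/
theorem exists_one_tmul_eq {a : SymTensorEndOp k V W} (ha : a ∈ symTensorEndOpPiece k V W 0) :
    ∃ f : Module.End k W, 1 ⊗ₜ MulOpposite.op f = a := by
  have h : symTensorEndOpPiece k V W 0 ≤
      LinearMap.range (TensorProduct.mk k (SymmetricAlgebra k (Module.Dual k V))
        (Module.End k W)ᵐᵒᵖ 1) := symTensorEndOpPiece_le fun s hs f => by
    rw [symPiece, pow_zero, Submodule.mem_one] at hs
    obtain ⟨c, rfl⟩ := hs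
    exact ⟨c • f, by rw [Algebra.algebraMap_eq_smul_one, TensorProduct.smul_tmul]; rfl⟩
  obtain ⟨f, rfl⟩ := h ha
  exact ⟨f.unop, rfl⟩

/-- Endomorphisms of the representation `W` as elements of degree zero of the invariant algebra. The
map is an isomorphism; only its surjectivity is needed. -/
noncomputable def endToInvariantPieceZero :
    (Module.End k[G] σ.asModule)ᵐᵒᵖ →+* invariantPiece ρ σ 0 where
  toFun f := ⟨⟨1 ⊗ₜ MulOpposite.op
      ((IntertwiningMap.equivLinearMapAsModule σ σ).symm f.unop).toLinearMap,
    mem_invariantAlgebra.2 fun g => by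
      rw [symTensorEndOpAct_tmul, map_one, MulOpposite.unop_op, linHom_apply,
        ← LinearMap.comp_assoc, ← IntertwiningMap.isIntertwining', LinearMap.comp_assoc,
        ← Module.End.mul_eq_comp (σ g), ← map_mul, mul_inv_cancel, map_one]
      rfl⟩, tmul_mem_symTensorEndOpPiece SetLike.GradedOne.one_mem _⟩
  map_one' := rfl
  map_mul' f g := Subtype.ext <| Subtype.ext <| by
    refine Eq.trans ?_ (Algebra.TensorProduct.tmul_mul_tmul ..).symm
    rw [mul_one]
    rfl
  map_zero' := Subtype.ext <| Subtype.ext <|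
    map_zero (TensorProduct.mk k (SymmetricAlgebra k (Module.Dual k V)) (Module.End k W)ᵐᵒᵖ 1)
  map_add' f g := Subtype.ext <| Subtype.ext <|
    map_add (TensorProduct.mk k (SymmetricAlgebra k (Module.Dual k V)) (Module.End k W)ᵐᵒᵖ 1)
      (MulOpposite.op ((IntertwiningMap.equivLinearMapAsModule σ σ).symm f.unop).toLinearMap)
      (MulOpposite.op ((IntertwiningMap.equivLinearMapAsModule σ σ).symm g.unop).toLinearMap)

theorem endToInvariantPieceZero_surjective :
    Function.Surjective (endToInvariantPieceZero ρ σ) := by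
  rintro ⟨⟨a, ha⟩, ha0⟩
  obtain ⟨f, rfl⟩ := exists_one_tmul_eq ha0
  have hf : ∀ g, linHom σ σ g f = f := fun g => by
    have h := mem_invariantAlgebra.1 ha g
    rw [symTensorEndOpAct_tmul, map_one, MulOpposite.unop_op] at h
    exact MulOpposite.op_injective (Algebra.TensorProduct.includeRight_injective
      (A := SymmetricAlgebra k (Module.Dual k V)) (algebraMap k _).injective h)
  refine ⟨MulOpposite.op (IntertwiningMap.equivLinearMapAsModule σ σ ⟨f, fun g => ?_⟩), rfl⟩
  nth_rewrite 1 [← hf g]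
  ext x
  simp

theorem isSemisimpleRing_invariantPiece_zero [Finite G] [CharZero k] [FiniteDimensional k W] :
    IsSemisimpleRing (invariantPiece ρ σ 0) := by
  have := Fintype.ofFinite G
  have : NeZero (Nat.card G : k) := ⟨Nat.cast_ne_zero.2 Nat.card_pos.ne'⟩
  have : Module.Finite k σ.asModule := inferInstance
  have : Module.Finite k[G] σ.asModule := Module.Finite.of_restrictScalars_finite k _ _
  have : IsSemisimpleRing (Module.End k[G] σ.asModule) := IsSemisimpleRing.moduleEnd _ _
  exact (endToInvariantPieceZero ρ σ).isSemisimpleRing_of_surjective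
    (endToInvariantPieceZero_surjective ρ σ)

end DegreeZero

/-! ### The invariant dual basis -/

section DualBasis

open Representation

variable {k : Type*} [Field k] {G : Type*} [Group G]
  {V : Type*} [AddCommGroup V] [Module k V] {W : Type*} [AddCommGroup W] [Module k W]
  {L : Type*} [AddCommGroup L] [Module k L]

/-- The action of `G` on the exterior algebra of a representation. -/
noncomputable def exteriorRep (θ : Representation k G L) :
    Representation k G (ExteriorAlgebra k L) where
  toFun g := (ExteriorAlgebra.map (θ g)).toLinearMap
  map_one' := by
    rw [map_one, Module.End.one_eq_id, ExteriorAlgebra.map_id]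
    rfl
  map_mul' g h := by
    rw [map_mul, Module.End.mul_eq_comp, ← ExteriorAlgebra.map_comp_map]
    rfl

theorem exteriorAlgebra_finite [FiniteDimensional k L] : Module.Finite k (ExteriorAlgebra k L) :=
  Module.Finite.of_basis (Module.finBasis k L).ExteriorAlgebra

variable (k V W) in
/-- The embedding of `End(W) ⊗ ⋀ L` in `(S^• V^* ⊗ End(W)^op) ⊗ ⋀ L`. -/
noncomputable def endTensorEmbed (E : Type*) [AddCommGroup E] [Module k E] :
    Module.End k W ⊗[k] E →ₗ[k] SymTensorEndOp k V W ⊗[k] E :=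
  (TensorProduct.mk k (SymmetricAlgebra k (Module.Dual k V)) (Module.End k W)ᵐᵒᵖ 1 ∘ₗ
    (MulOpposite.opLinearEquiv k).toLinearMap).rTensor E

theorem endTensorEmbed_tmul {E : Type*} [AddCommGroup E] [Module k E] (f : Module.End k W) (e : E) :
    endTensorEmbed k V W E (f ⊗ₜ e) = (1 ⊗ₜ MulOpposite.op f) ⊗ₜ e := rfl

theorem coeffProj_endTensorEmbed (t : Module.End k W ⊗[k] ExteriorAlgebra k L) :
    coeffProj L (symTensorEndOpPiece k V W) 0 (endTensorEmbed k V W _ t) =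
      endTensorEmbed k V W _ t := by
  induction t using TensorProduct.induction_on with
  | zero => simp
  | add t t' ht ht' => simp only [map_add, ht, ht']
  | tmul f e =>
    rw [endTensorEmbed_tmul, coeffProj_tmul, GradedAlgebra.proj_apply,
      DirectSum.decompose_of_mem_same (symTensorEndOpPiece k V W)
        (tmul_mem_symTensorEndOpPiece SetLike.GradedOne.one_mem _)]

variable [FiniteDimensional k W]

/-- Under the identification of `Hom(W, W ⊗ E)` with `End(W) ⊗ E`, precomposition with an
endomorphism is left multiplication in `End(W)^op`. -/
theorem endTensorEmbed_symm_comp {E : Type*} [AddCommGroup E] [Module k E]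
    (F : W →ₗ[k] W ⊗[k] E) (h : Module.End k W) :
    endTensorEmbed k V W E ((rTensorHomEquivHomRTensor k W W E).symm (F ∘ₗ h)) =
      ((1 : SymmetricAlgebra k (Module.Dual k V)) ⊗ₜ[k] MulOpposite.op h) •
        endTensorEmbed k V W E ((rTensorHomEquivHomRTensor k W W E).symm F) := by
  obtain ⟨t, rfl⟩ := (rTensorHomEquivHomRTensor k W W E).surjective F
  rw [LinearEquiv.symm_apply_apply]
  induction t using TensorProduct.induction_on with
  | zero => simp
  | add t t' ht ht' => simp only [map_add, LinearMap.add_comp, ht, ht', smul_add]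
  | tmul f e =>
    have : rTensorHomEquivHomRTensor k W W E (f ⊗ₜ e) ∘ₗ h =
        rTensorHomEquivHomRTensor k W W E ((f ∘ₗ h) ⊗ₜ e) := by
      ext w
      simp [rTensorHomEquivHomRTensor_apply]
    rw [this, LinearEquiv.symm_apply_apply, endTensorEmbed_tmul, endTensorEmbed_tmul,
      TensorProduct.smul_tmul', smul_eq_mul, Algebra.TensorProduct.tmul_mul_tmul, mul_one]
    rfl

/-- The identification of `Hom(W, W ⊗ ⋀ L)` with `End(W) ⊗ ⋀ L` is equivariant. -/
theorem diagAct_endTensorEmbed_symm (ρ : Representation k G V) (σ : Representation k G W)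
    (θ : Representation k G L) (g : G) (F : W →ₗ[k] W ⊗[k] ExteriorAlgebra k L) :
    diagAct (symTensorEndOpActHom ρ σ) θ g
        (endTensorEmbed k V W _ ((rTensorHomEquivHomRTensor k W W _).symm F)) =
      endTensorEmbed k V W _ ((rTensorHomEquivHomRTensor k W W _).symm
        (linHom σ (σ.tprod (exteriorRep θ)) g F)) := by
  obtain ⟨t, rfl⟩ := (rTensorHomEquivHomRTensor k W W (ExteriorAlgebra k L)).surjective F
  rw [LinearEquiv.symm_apply_apply]
  induction t using TensorProduct.induction_on with
  | zero => simp
  | add t t' ht ht' => simp only [map_add, ht, ht']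
  | tmul f e =>
    have : linHom σ (σ.tprod (exteriorRep θ)) g (rTensorHomEquivHomRTensor k W W _ (f ⊗ₜ e)) =
        rTensorHomEquivHomRTensor k W W _ (linHom σ σ g f ⊗ₜ exteriorRep θ g e) := by
      ext w
      simp [rTensorHomEquivHomRTensor_apply]
    rw [this, LinearEquiv.symm_apply_apply, endTensorEmbed_tmul, endTensorEmbed_tmul,
      diagAct_tmul]
    congr 1
    refine (symTensorEndOpAct_tmul ρ σ g _ _).trans ?_
    rw [map_one]
    rfl

/-- Intertwining maps `a j`, `b j` exhibiting `W ⊗ ⋀ L` as a direct summand of a multiple of `W`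
give an invariant dual basis. Its functionals send `ω` to the endomorphism `w ↦ b j (w ⊗ ω)`, and
its vectors are the maps `a j`, viewed as elements of `End(W) ⊗ ⋀ L`. -/
noncomputable def invariantDualBasis (ρ : Representation k G V) (σ : Representation k G W)
    (θ : Representation k G L) {n : ℕ} (a : Fin n → W →ₗ[k] W ⊗[k] ExteriorAlgebra k L)
    (b : Fin n → W ⊗[k] ExteriorAlgebra k L →ₗ[k] W)
    (ha : ∀ j g, a j ∘ₗ σ g = σ.tprod (exteriorRep θ) g ∘ₗ a j)
    (hb : ∀ j g, b j ∘ₗ σ.tprod (exteriorRep θ) g = σ g ∘ₗ b j)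
    (hab : ∑ j, a j ∘ₗ b j = LinearMap.id) :
    InvariantDualBasis (symTensorEndOpPiece k V W) (symTensorEndOpActHom ρ σ) θ (Fin n) where
  coord j := TensorProduct.mk k _ _ 1 ∘ₗ (MulOpposite.opLinearEquiv k).toLinearMap ∘ₗ
    LinearMap.llcomp k W (W ⊗[k] ExteriorAlgebra k L) W (b j) ∘ₗ
      (TensorProduct.mk k W (ExteriorAlgebra k L)).flip
  vec j := endTensorEmbed k V W _ ((rTensorHomEquivHomRTensor k W W _).symm (a j))
  coord_mem j ω := tmul_mem_symTensorEndOpPiece SetLike.GradedOne.one_mem _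
  act_coord g j ω := by
    refine (symTensorEndOpAct_tmul ρ σ g _ _).trans ?_
    rw [map_one]
    refine congrArg (fun f => 1 ⊗ₜ MulOpposite.op f) (LinearMap.ext fun w => ?_)
    have h := LinearMap.congr_fun (hb j g) (σ g⁻¹ w ⊗ₜ ω)
    simpa [exteriorRep] using h.symm
  diagAct_vec g j := by
    rw [diagAct_endTensorEmbed_symm, linHom_apply, ← LinearMap.comp_assoc, ← ha,
      LinearMap.comp_assoc, ← Module.End.mul_eq_comp, ← map_mul, mul_inv_cancel, map_one]
    rfl
  coeffProj_vec j := coeffProj_endTensorEmbed _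
  sum_coord_smul_vec ω := by
    refine (Finset.sum_congr rfl fun j _ =>
      (endTensorEmbed_symm_comp (a j) _).symm).trans ?_
    rw [← map_sum, ← map_sum]
    have h : rTensorHomEquivHomRTensor k W W (ExteriorAlgebra k L) (1 ⊗ₜ ω) =
        ∑ j, a j ∘ₗ LinearMap.llcomp k W (W ⊗[k] ExteriorAlgebra k L) W (b j)
          ((TensorProduct.mk k W (ExteriorAlgebra k L)).flip ω) := by
      ext w
      have := LinearMap.congr_fun hab (w ⊗ₜ ω)
      simpa [rTensorHomEquivHomRTensor_apply] using this.symm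
    exact (congrArg _ ((LinearEquiv.symm_apply_eq _).2 h.symm)).trans (endTensorEmbed_tmul _ _)

end DualBasis

/-- The universe levels are named here to fix the common universe of `A` and `B` in the theorem on
the Ext algebra. -/
theorem IsCompleteIrreducibleFamily.isKoszulAlgebra.{a, b, c, d} {G : Type d} [Group G] [Finite G]
    {V : Type a} [AddCommGroup V] [Module ℂ V] [FiniteDimensional ℂ V] (ρ : Representation ℂ G V)
    {ι : Type b} {U : ι → Type c} [∀ i, AddCommGroup (U i)] [∀ i, Module ℂ (U i)]
    (σ : ∀ i, Representation ℂ G (U i)) (hσ : IsCompleteIrreducibleFamily σ) :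
    IsKoszulAlgebra (invariantPiece ρ (Representation.directSum σ)) := by
  have := hσ.finiteDimensional_directSum
  have := exteriorAlgebra_finite (k := ℂ) (L := Module.Dual ℂ V)
  have := isSemisimpleRing_invariantPiece_zero ρ (Representation.directSum σ)
  obtain ⟨n, a, b, ha, hb, hab⟩ := hσ.exists_sum_comp_eq_id
    ((Representation.directSum σ).tprod (exteriorRep ρ.dual))
  have h := isEquivariantSystem_symTensorEndOp ρ (Representation.directSum σ)
    (Module.finBasis ℂ (Module.Dual ℂ V))
  have δ := invariantDualBasis ρ (Representation.directSum σ) ρ.dual a b ha hb hab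
  exact ⟨this, adjoin_zero_one_eq_top (fun _ => mem_invariantAlgebra) h δ fun _ _ => Iff.rfl,
    extAlgebraGeneratedInDegreeOne_degreeZeroModule.{0, a, max b c}
      (fun _ => mem_invariantAlgebra) h δ fun _ _ => Iff.rfl⟩

theorem theorem2p3 {G : Type*} [Group G] [Finite G]
    {V : Type*} [AddCommGroup V] [Module ℂ V] [FiniteDimensional ℂ V] (ρ : Representation ℂ G V)
    {ι : Type*} {U : ι → Type*} [∀ i, AddCommGroup (U i)] [∀ i, Module ℂ (U i)]
    (σ : ∀ i, Representation ℂ G (U i)) (hσ : IsCompleteIrreducibleFamily σ) :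
    IsKoszulAlgebra (invariantPiece ρ (Representation.directSum σ)) :=
  hσ.isKoszulAlgebra ρ
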